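/- **Theorem.** Let $d\ge 0$ and $m\ge 1$ be integers and let $\alpha_0,\dots,\alpha_m\in(\mathbb N\cup\{0\})^d$ be multi-indices. Suppose there are vectors $\Gamma,\Lambda\in(\mathbb N\cup\{0\})^d$, with $\Gamma_i=0$ for every $i$ such that $\Lambda_i=0$ (no restriction on $\Gamma$ if all entries of $\Lambda$ are positive), such that $$\langle\alpha_0,\Lambda\rangle=\langle\alpha_1,\Lambda\rangle=\dots=\langle\alpha_m,\Lambda\rangle$$ and $$\langle\alpha_0,\Gamma\rangle<\langle\alpha_1,\Gamma\rangle<\langle\alpha_2,\Gamma\rangle\le\dots\le\langle\alpha_m,\Gamma\rangle$$ (for $m=1$ the second condition is just $\langle\alpha_0,\Gamma\rangle<\langle\alpha_1,\Gamma\rangle$). Then for every real $K>0$ there exists a real-valued $f\in C^\infty(\mathbb T^d)$, where $\mathbb T^d=(\mathbb R/\mathbb Z)^d$, such that $D^{\alpha_1}f$ is not identically zero and $$\|D^{\alpha_1}f\|_{L^1(\mathbb T^d)}\ \ge\ K\sum_{\substack{0\le j\le m\\ j\ne 1}}\|D^{\alpha_j}f\|_{L^1(\mathbb T^d)}.$$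 Here $D^{\alpha}=\partial^{|\alpha|}/\partial x_1^{\alpha(1)}\cdots\partial x_d^{\alpha(d)}$, and the $L^1$ norm is taken with respect to the normalized Lebesgue (Haar) measure. -/

import Mathlib

open scoped ContDiff

noncomputable section

namespace TorusDeriv

/-- A real function on the torus `𝕋^d = (ℝ/ℤ)^d` is smooth if its `ℤ^d`-periodic lift to `ℝ^d`
is `C^∞`. -/
def IsSmooth {d : ℕ} (f : UnitAddTorus (Fin d) → ℝ) : Prop :=
  ContDiff ℝ ∞ (fun x : Fin d → ℝ => f (fun i => (x i : UnitAddCircle)))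

/-- The partial derivative `∂f/∂x_i` of a function on the torus. -/
def partialDeriv {d : ℕ} (i : Fin d) (f : UnitAddTorus (Fin d) → ℝ) :
    UnitAddTorus (Fin d) → ℝ :=
  fun x => deriv (fun t : ℝ => f (x + Pi.single i (t : UnitAddCircle))) 0

/-- The derivative `D^α f = ∂_1^{α_1} (∂_2^{α_2} (⋯ (∂_d^{α_d} f)))` for a multi-index `α`. -/
def multiDeriv {d : ℕ} (α : Fin d → ℕ) (f : UnitAddTorus (Fin d) → ℝ) :
    UnitAddTorus (Fin d) → ℝ :=
  (List.finRange d).foldr (fun i g => (partialDeriv i)^[α i] g) f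

/-- The `L^1` norm on the torus, with respect to its normalized Haar (Lebesgue) measure. -/
def normL1 {d : ℕ} (f : UnitAddTorus (Fin d) → ℝ) : ℝ :=
  ∫ x, |f x| ∂(MeasureTheory.Measure.pi fun _ : Fin d => AddCircle.haarAddCircle (T := 1))

end TorusDeriv

end

noncomputable section

namespace TorusDeriv

open MeasureTheory Filter Topology

variable {d : ℕ}

/-! Coordinates with `Λ i = 0` are split off first. The final function is a product `f x * g x`,
with `f` independent of these coordinates and `g` depending only on them, so each derivative and its
norm factor. As `Γ` vanishes there too, deleting those letters preserves both weights of every word.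
What remains are words `w₀`, `w₁`, `v j` of common `Λ`-weight `c`, with letters of positive
`Λ`-weight.

Equal `Λ`-weight makes the superposition `h + N^{-c} g · f(dilate x)` act alike on all these words:
as `N → ∞`, its derivative along `w` is `D^w h(x) + g(x) D^w f(y)`, with `x` and `y` asymptotically
independent by Fejér's lemma. With the density `g = 1 + D^{w₀} h` (nonnegative, mean one), `1 +
D^{w₀} f` is multiplied by `g`, as in a Riesz product, so its `L¹` norm stays near 1 through all
rounds.

The block `h` is a ridge function whose frequencies encode `Γ`: with `P = Γ(w₁) - Γ(w₀)`, its
derivatives along `w₀`, `w₁`, `v j` have sizes 1, `M^{-P}`, at most `M^{-P-1}`. For the norm along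
`w₁` to grow by a fixed multiple of `M^{-P}`, a damping superposition with a bump density precedes
each cosine block: it makes `D^{w₁} f` nearly vanish on a set of fixed measure, where the new block
contributes fully. After `n` rounds the norm along `w₁` is at least about `n κ M^{-P}`, along `v j`
at most about `n C M^{-P-1}`, and along `w₀` bounded. Taking `M` large and then `n` large gives the
claim. The carrying lemmas are `tendsto_integral_comp_dilate`, `le_integral_abs_add_mul` and
`WordSystem.exists_increment`. -/

/-- The quotient map `ℝ^d → 𝕋^d`. -/
def toTorus (x : Fin d → ℝ) : UnitAddTorus (Fin d) := fun i => (x i : UnitAddCircle)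

theorem isOpenQuotientMap_toTorus : IsOpenQuotientMap (toTorus (d := d)) :=
  IsOpenQuotientMap.piMap (f := fun (_ : Fin d) (t : ℝ) => (t : UnitAddCircle))
    fun _ => QuotientAddGroup.isOpenQuotientMap_mk

theorem toTorus_add_smul_single (x : Fin d → ℝ) (i : Fin d) (t : ℝ) :
    toTorus (x + t • Pi.single i 1) = toTorus x + Pi.single i (t : UnitAddCircle) := by
  ext j
  rcases eq_or_ne j i with rfl | h
  · simp [toTorus]
  · simp [toTorus, h]

/-! ### Smooth functions and their partial derivatives -/

theorem IsSmooth.continuous {f : UnitAddTorus (Fin d) → ℝ} (hf : IsSmooth f) : Continuous f :=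
  isOpenQuotientMap_toTorus.isQuotientMap.continuous_iff.2 (ContDiff.continuous hf)

theorem IsSmooth.partialDeriv_toTorus {f : UnitAddTorus (Fin d) → ℝ} (hf : IsSmooth f) (i : Fin d)
    (x : Fin d → ℝ) :
    partialDeriv i f (toTorus x) = fderiv ℝ (fun y => f (toTorus y)) x (Pi.single i 1) := by
  have h : DifferentiableAt ℝ (fun y => f (toTorus y)) x :=
    (ContDiff.differentiable hf (by simp)) x
  simp only [partialDeriv, ← toTorus_add_smul_single]
  exact h.lineDeriv_eq_fderiv

theorem IsSmooth.differentiableAt_slice {f : UnitAddTorus (Fin d) → ℝ} (hf : IsSmooth f)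
    (i : Fin d) (x : UnitAddTorus (Fin d)) (t : ℝ) :
    DifferentiableAt ℝ (fun t : ℝ => f (x + Pi.single i (t : UnitAddCircle))) t := by
  obtain ⟨x, rfl⟩ := isOpenQuotientMap_toTorus.surjective x
  simp only [← toTorus_add_smul_single]
  have h : Differentiable ℝ (fun y => f (toTorus y)) := ContDiff.differentiable hf (by simp)
  exact (h.comp (by fun_prop : Differentiable ℝ fun t : ℝ => x + t • Pi.single i 1)) t

theorem IsSmooth.partialDeriv {f : UnitAddTorus (Fin d) → ℝ} (hf : IsSmooth f) (i : Fin d) :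
    IsSmooth (partialDeriv i f) := by
  have h : (fun x => TorusDeriv.partialDeriv i f (toTorus x)) =
      fun x => fderiv ℝ (fun y => f (toTorus y)) x (Pi.single i 1) :=
    funext (hf.partialDeriv_toTorus i)
  change ContDiff ℝ ∞ (fun x => TorusDeriv.partialDeriv i f (toTorus x))
  rw [h]
  exact (ContDiff.fderiv_right (m := ∞) hf (by simp)).clm_apply contDiff_const

theorem isSmooth_const (c : ℝ) : IsSmooth (d := d) fun _ => c := contDiff_const

theorem IsSmooth.add {f g : UnitAddTorus (Fin d) → ℝ} (hf : IsSmooth f) (hg : IsSmooth g) :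
    IsSmooth fun x => f x + g x := ContDiff.add hf hg

theorem IsSmooth.mul {f g : UnitAddTorus (Fin d) → ℝ} (hf : IsSmooth f) (hg : IsSmooth g) :
    IsSmooth fun x => f x * g x := ContDiff.mul hf hg

theorem IsSmooth.const_mul {f : UnitAddTorus (Fin d) → ℝ} (c : ℝ) (hf : IsSmooth f) :
    IsSmooth fun x => c * f x := (isSmooth_const c).mul hf

theorem partialDeriv_const (i : Fin d) (c : ℝ) : partialDeriv i (fun _ => c) = fun _ => 0 := by
  ext x; simp [partialDeriv]

theorem partialDeriv_add {f g : UnitAddTorus (Fin d) → ℝ} (hf : IsSmooth f) (hg : IsSmooth g)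
    (i : Fin d) :
    partialDeriv i (fun x => f x + g x) = fun x => partialDeriv i f x + partialDeriv i g x := by
  ext x
  exact deriv_fun_add (hf.differentiableAt_slice i x 0) (hg.differentiableAt_slice i x 0)

theorem partialDeriv_const_mul (i : Fin d) (c : ℝ) (f : UnitAddTorus (Fin d) → ℝ) :
    partialDeriv i (fun x => c * f x) = fun x => c * partialDeriv i f x := by
  ext x
  exact deriv_const_mul_field _

theorem partialDeriv_mul {f g : UnitAddTorus (Fin d) → ℝ} (hf : IsSmooth f) (hg : IsSmooth g)
    (i : Fin d) : partialDeriv i (fun x => f x * g x) =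
      fun x => partialDeriv i f x * g x + f x * partialDeriv i g x := by
  ext x
  simpa [partialDeriv] using
    deriv_fun_mul (hf.differentiableAt_slice i x 0) (hg.differentiableAt_slice i x 0)

/-! ### Iterated partial derivatives along words -/

/-- The iterated derivative `∂_{i_1} (∂_{i_2} (⋯ f))` along a word `[i_1, i_2, …]`. -/
def wordDeriv (w : List (Fin d)) (f : UnitAddTorus (Fin d) → ℝ) : UnitAddTorus (Fin d) → ℝ :=
  w.foldr partialDeriv f

@[simp] theorem wordDeriv_nil (f : UnitAddTorus (Fin d) → ℝ) : wordDeriv [] f = f := rfl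

@[simp] theorem wordDeriv_cons (i : Fin d) (w : List (Fin d)) (f : UnitAddTorus (Fin d) → ℝ) :
    wordDeriv (i :: w) f = partialDeriv i (wordDeriv w f) := rfl

/-- The word of a multi-index: the letter `i` is repeated `α i` times. -/
def word (α : Fin d → ℕ) : List (Fin d) :=
  (List.finRange d).flatMap fun i => List.replicate (α i) i

/-- Words permit induction one letter at a time, and restriction to a set of coordinates by
filtering. -/
theorem multiDeriv_eq_wordDeriv (α : Fin d → ℕ) (f : UnitAddTorus (Fin d) → ℝ) :
    multiDeriv α f = wordDeriv (word α) f := by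
  have h (i : Fin d) (n : ℕ) (g : UnitAddTorus (Fin d) → ℝ) :
      (partialDeriv i)^[n] g = (List.replicate n i).foldr partialDeriv g := by
    induction n with
    | zero => rfl
    | succ n ih => rw [Function.iterate_succ_apply', ih]; rfl
  simp only [multiDeriv, wordDeriv, word]
  induction List.finRange d with
  | nil => rfl
  | cons i l ih => simp only [List.foldr_cons, List.flatMap_cons, List.foldr_append, ← ih, h]

theorem sum_map_word (α β : Fin d → ℕ) : ((word α).map β).sum = α ⬝ᵥ β := by
  rw [dotProduct, ← List.sum_ofFn, List.ofFn_eq_map, word]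
  induction List.finRange d with
  | nil => rfl
  | cons i l ih => simp [ih]

theorem IsSmooth.wordDeriv {f : UnitAddTorus (Fin d) → ℝ} (hf : IsSmooth f) (w : List (Fin d)) :
    IsSmooth (wordDeriv w f) := by
  induction w with
  | nil => exact hf
  | cons i w ih => exact ih.partialDeriv i

theorem wordDeriv_add {f g : UnitAddTorus (Fin d) → ℝ} (hf : IsSmooth f) (hg : IsSmooth g)
    (w : List (Fin d)) :
    wordDeriv w (fun x => f x + g x) = fun x => wordDeriv w f x + wordDeriv w g x := by
  induction w with
  | nil => rfl
  | cons i w ih =>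
    simp only [wordDeriv_cons, ih]
    exact partialDeriv_add (hf.wordDeriv w) (hg.wordDeriv w) i

theorem wordDeriv_const_mul (w : List (Fin d)) (c : ℝ) (f : UnitAddTorus (Fin d) → ℝ) :
    wordDeriv w (fun x => c * f x) = fun x => c * wordDeriv w f x := by
  induction w with
  | nil => rfl
  | cons i w ih => simp only [wordDeriv_cons, ih, partialDeriv_const_mul]

theorem wordDeriv_zero (w : List (Fin d)) : wordDeriv w (fun _ => 0) = fun _ => 0 := by
  simpa using wordDeriv_const_mul w 0 fun _ => 0

/-! ### Functions of the variables outside a set of coordinates -/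

/-- `f` does not depend on the coordinates in `S`. -/
def IndepOf (S : Set (Fin d)) (f : UnitAddTorus (Fin d) → ℝ) : Prop :=
  ∀ x s : UnitAddTorus (Fin d), (∀ i, i ∉ S → s i = 0) → f (x + s) = f x

theorem IndepOf.partialDeriv {S : Set (Fin d)} {f : UnitAddTorus (Fin d) → ℝ} (hf : IndepOf S f)
    (i : Fin d) : IndepOf S (partialDeriv i f) := fun x s hs => by
  simp only [TorusDeriv.partialDeriv, add_right_comm x s, hf _ s hs]

theorem IndepOf.wordDeriv {S : Set (Fin d)} {f : UnitAddTorus (Fin d) → ℝ} (hf : IndepOf S f)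
    (w : List (Fin d)) : IndepOf S (wordDeriv w f) := by
  induction w with
  | nil => exact hf
  | cons i w ih => exact ih.partialDeriv i

theorem IndepOf.partialDeriv_eq_zero {S : Set (Fin d)} {f : UnitAddTorus (Fin d) → ℝ}
    (hf : IndepOf S f) {i : Fin d} (hi : i ∈ S) : TorusDeriv.partialDeriv i f = fun _ => 0 := by
  ext x
  have h (t : ℝ) : f (x + Pi.single i (t : UnitAddCircle)) = f x :=
    hf x _ fun j hj => Pi.single_eq_of_ne (by rintro rfl; exact hj hi) _
  simp [TorusDeriv.partialDeriv, h]

theorem indepOf_const (S : Set (Fin d)) (c : ℝ) : IndepOf S fun _ => c := fun _ _ _ => rfl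

theorem IndepOf.add {S : Set (Fin d)} {f g : UnitAddTorus (Fin d) → ℝ} (hf : IndepOf S f)
    (hg : IndepOf S g) : IndepOf S fun x => f x + g x := fun x s hs => by
  simp only [hf x s hs, hg x s hs]

theorem IndepOf.mul {S : Set (Fin d)} {f g : UnitAddTorus (Fin d) → ℝ} (hf : IndepOf S f)
    (hg : IndepOf S g) : IndepOf S fun x => f x * g x := fun x s hs => by
  simp only [hf x s hs, hg x s hs]

/-- Each letter annihilates one of the two factors, so only one term of the Leibniz rule survives.
-/
theorem wordDeriv_mul_of_indepOf {S : Set (Fin d)} [DecidablePred (· ∈ S)]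
    {f g : UnitAddTorus (Fin d) → ℝ} (hf : IsSmooth f) (hg : IsSmooth g)
    (hfS : IndepOf S f) (hgS : IndepOf Sᶜ g) (w : List (Fin d)) :
    wordDeriv w (fun x => f x * g x) = fun x =>
      wordDeriv (w.filter (· ∉ S)) f x * wordDeriv (w.filter (· ∈ S)) g x := by
  induction w with
  | nil => rfl
  | cons i w ih =>
    rw [wordDeriv_cons, ih, partialDeriv_mul (hf.wordDeriv _) (hg.wordDeriv _)]
    by_cases hi : i ∈ S
    · simp [hi, (hfS.wordDeriv _).partialDeriv_eq_zero hi]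
    · simp [hi, (hgS.wordDeriv _).partialDeriv_eq_zero hi]

/-! ### Dilations -/

/-- The anisotropic dilation `x ↦ ((n + 1)^{Λ_i} x_i)_i` of the torus. -/
def dilate (Λ : Fin d → ℕ) (n : ℕ) (x : UnitAddTorus (Fin d)) : UnitAddTorus (Fin d) :=
  fun i => (n + 1) ^ Λ i • x i

theorem dilate_add (Λ : Fin d → ℕ) (n : ℕ) (x y : UnitAddTorus (Fin d)) :
    dilate Λ n (x + y) = dilate Λ n x + dilate Λ n y := by
  ext i; simp [dilate]

theorem continuous_dilate (Λ : Fin d → ℕ) (n : ℕ) : Continuous (dilate Λ n) := by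
  unfold dilate; fun_prop

theorem IsSmooth.comp_dilate {f : UnitAddTorus (Fin d) → ℝ} (hf : IsSmooth f) (Λ : Fin d → ℕ)
    (n : ℕ) : IsSmooth fun x => f (dilate Λ n x) := by
  have h : ContDiff ℝ ∞ fun (x : Fin d → ℝ) (i : Fin d) => ((n + 1) ^ Λ i : ℕ) • x i := by
    fun_prop
  have h' : (fun x : Fin d → ℝ => f (dilate Λ n (toTorus x))) =
      (fun x => f (toTorus x)) ∘ fun x i => ((n + 1) ^ Λ i : ℕ) • x i := by
    ext x
    simp only [Function.comp]
    congr 1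
  change ContDiff ℝ ∞ fun x : Fin d → ℝ => f (dilate Λ n (toTorus x))
  rw [h']
  exact ContDiff.comp (g := fun x => f (toTorus x)) hf h

theorem IndepOf.comp_dilate {S : Set (Fin d)} {f : UnitAddTorus (Fin d) → ℝ} (hf : IndepOf S f)
    (Λ : Fin d → ℕ) (n : ℕ) : IndepOf S fun x => f (dilate Λ n x) := fun x s hs => by
  simp only [dilate_add]
  exact hf _ _ fun i hi => by simp [dilate, hs i hi]

theorem partialDeriv_comp_dilate (f : UnitAddTorus (Fin d) → ℝ) (Λ : Fin d → ℕ) (n : ℕ)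
    (i : Fin d) : partialDeriv i (fun x => f (dilate Λ n x)) =
      fun x => (n + 1 : ℝ) ^ Λ i * partialDeriv i f (dilate Λ n x) := by
  ext x
  have h (t : ℝ) : dilate Λ n (Pi.single i (t : UnitAddCircle)) =
      Pi.single i (((n + 1 : ℝ) ^ Λ i * t : ℝ) : UnitAddCircle) := by
    ext j
    rcases eq_or_ne j i with rfl | h
    · have : (n + 1 : ℝ) ^ Λ j * t = ((n + 1) ^ Λ j : ℕ) • t := by simp
      simp only [this, dilate, Pi.single_eq_same]
      rfl
    · simp [dilate, h]
  simp only [partialDeriv, dilate_add, h]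
  simpa using deriv_comp_mul_left ((n + 1 : ℝ) ^ Λ i)
    (fun t : ℝ => f (dilate Λ n x + Pi.single i (t : UnitAddCircle))) 0

/-! ### Derivatives of products with rapidly oscillating functions -/

/-- Finite sums of families `(n + 1)^{-e} g(x) f(dilate Λ n x)` with `e ≥ 1` and `f`, `g` smooth. -/
inductive Negligible (Λ : Fin d → ℕ) : (ℕ → UnitAddTorus (Fin d) → ℝ) → Prop
  | zero : Negligible Λ fun _ _ => 0
  | add {u v : ℕ → UnitAddTorus (Fin d) → ℝ} : Negligible Λ u → Negligible Λ v →
      Negligible Λ fun n x => u n x + v n x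
  | term (e : ℕ) (he : 1 ≤ e) (g f : UnitAddTorus (Fin d) → ℝ) : IsSmooth g → IsSmooth f →
      Negligible Λ fun n x => ((n + 1 : ℝ) ^ e)⁻¹ * (g x * f (dilate Λ n x))

theorem Negligible.isSmooth {Λ : Fin d → ℕ} {u : ℕ → UnitAddTorus (Fin d) → ℝ}
    (hu : Negligible Λ u) (n : ℕ) : IsSmooth (u n) := by
  induction hu with
  | zero => exact isSmooth_const 0
  | add _ _ h₁ h₂ => exact h₁.add h₂
  | term e he g f hg hf => exact (hg.mul (hf.comp_dilate Λ n)).const_mul _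

theorem partialDeriv_mul_comp_dilate {f g : UnitAddTorus (Fin d) → ℝ} (hf : IsSmooth f)
    (hg : IsSmooth g) (Λ : Fin d → ℕ) (n : ℕ) (i : Fin d) :
    (fun x => ((n + 1 : ℝ) ^ Λ i)⁻¹ * partialDeriv i (fun x => g x * f (dilate Λ n x)) x) =
      fun x => g x * partialDeriv i f (dilate Λ n x) +
        ((n + 1 : ℝ) ^ Λ i)⁻¹ * (partialDeriv i g x * f (dilate Λ n x)) := by
  ext x
  rw [partialDeriv_mul hg (hf.comp_dilate Λ n), partialDeriv_comp_dilate]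
  have : (n + 1 : ℝ) ≠ 0 := by positivity
  field_simp
  ring

/-- A derivative falling on `f` produces exactly the power that the normalization cancels; one
falling on `g` only improves the decay. -/
theorem Negligible.partialDeriv {Λ : Fin d → ℕ} {u : ℕ → UnitAddTorus (Fin d) → ℝ}
    (hu : Negligible Λ u) (i : Fin d) :
    Negligible Λ fun n x => ((n + 1 : ℝ) ^ Λ i)⁻¹ * TorusDeriv.partialDeriv i (u n) x := by
  induction hu with
  | zero => simpa [partialDeriv_const] using Negligible.zero
  | add hu hv h₁ h₂ =>
    simp only [partialDeriv_add (hu.isSmooth _) (hv.isSmooth _), mul_add]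
    exact h₁.add h₂
  | term e he g f hg hf =>
    convert (Negligible.term e he g _ hg (hf.partialDeriv i)).add
      (Negligible.term (Λ := Λ) (e + Λ i) (by omega) _ f (hg.partialDeriv i) hf) using 3 with n x
    have h := congrFun (partialDeriv_mul_comp_dilate hf hg Λ n i) x
    rw [partialDeriv_const_mul, mul_left_comm, h, pow_add, mul_inv]
    ring

theorem Negligible.eventually_le {Λ : Fin d → ℕ} {u : ℕ → UnitAddTorus (Fin d) → ℝ}
    (hu : Negligible Λ u) {ε : ℝ} (hε : 0 < ε) : ∀ᶠ n in atTop, ∀ x, |u n x| ≤ ε := by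
  induction hu generalizing ε with
  | zero => simp [hε.le]
  | add _ _ h₁ h₂ =>
    filter_upwards [h₁ (half_pos hε), h₂ (half_pos hε)] with n h h' x
    exact (abs_add_le _ _).trans (by linarith [h x, h' x])
  | term e he g f hg hf =>
    obtain ⟨G, hG⟩ := isCompact_univ.exists_bound_of_continuousOn hg.continuous.continuousOn
    obtain ⟨F, hF⟩ := isCompact_univ.exists_bound_of_continuousOn hf.continuous.continuousOn
    have h : Tendsto (fun n : ℕ => (((n + 1 : ℕ) : ℝ) ^ e)⁻¹ * (G * F)) atTop (𝓝 (0 * (G * F))) :=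
      ((tendsto_inv_atTop_zero.comp ((tendsto_pow_atTop (by omega)).comp
        tendsto_natCast_atTop_atTop)).comp (tendsto_add_atTop_nat 1)).mul_const _
    rw [zero_mul] at h
    filter_upwards [h.eventually (eventually_le_nhds hε)] with n hn x
    refine le_trans ?_ hn
    push_cast
    rw [abs_mul, abs_mul, abs_of_nonneg (by positivity : 0 ≤ ((n + 1 : ℝ) ^ e)⁻¹)]
    have h₁ := hG x trivial
    have h₂ := hF (dilate Λ n x) trivial
    rw [Real.norm_eq_abs] at h₁ h₂
    gcongr
    exact (abs_nonneg _).trans h₁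

/-- Up to negligible terms, the normalized derivative of `g · f(dilate Λ n ·)` falls on `f`. -/
theorem negligible_wordDeriv_mul_comp_dilate {Λ : Fin d → ℕ} {f g : UnitAddTorus (Fin d) → ℝ}
    (hf : IsSmooth f) (hg : IsSmooth g) {w : List (Fin d)} (hw : ∀ i ∈ w, Λ i ≠ 0) :
    ∃ u, Negligible Λ u ∧ ∀ (n : ℕ) x, ((n + 1 : ℝ) ^ (w.map Λ).sum)⁻¹ *
      wordDeriv w (fun x => g x * f (dilate Λ n x)) x =
        g x * wordDeriv w f (dilate Λ n x) + u n x := by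
  induction w with
  | nil => exact ⟨_, Negligible.zero, fun n x => by simp⟩
  | cons i w ih =>
    obtain ⟨u, hu, h⟩ := ih fun j hj => hw j (List.mem_cons_of_mem _ hj)
    -- The new error comes from the derivative falling on `g`; it decays because `Λ i ≥ 1`.
    refine ⟨_, (Negligible.term (Λ i) (Nat.one_le_iff_ne_zero.2 (hw i List.mem_cons_self)) _ _
      (hg.partialDeriv i) (hf.wordDeriv w)).add (hu.partialDeriv i), fun n x => ?_⟩
    have h₁ : (fun x => ((n + 1 : ℝ) ^ (w.map Λ).sum)⁻¹ *
        wordDeriv w (fun x => g x * f (dilate Λ n x)) x) =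
        fun x => g x * wordDeriv w f (dilate Λ n x) + u n x := funext (h n)
    have h₂ := congrFun (congrArg (partialDeriv i) h₁) x
    have h₃ := congrFun (partialDeriv_mul_comp_dilate (hf.wordDeriv w) hg Λ n i) x
    rw [partialDeriv_const_mul, partialDeriv_add (hg.mul ((hf.wordDeriv w).comp_dilate Λ n))
      (hu.isSmooth n)] at h₂
    simp only [List.map_cons, List.sum_cons, wordDeriv_cons, pow_add, mul_inv]
    dsimp only at h₂ h₃
    rw [mul_assoc, h₂, mul_add, h₃]
    ring

/-! ### Integrals of rapidly oscillating functions -/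

/-- The normalized Haar measure on the torus. -/
abbrev torusMeasure (d : ℕ) : Measure (UnitAddTorus (Fin d)) :=
  Measure.pi fun _ : Fin d => AddCircle.haarAddCircle (T := 1)

theorem integrable_of_continuous {f : UnitAddTorus (Fin d) → ℝ} (hf : Continuous f) :
    Integrable f (torusMeasure d) :=
  hf.integrable_of_hasCompactSupport (HasCompactSupport.of_compactSpace f)

theorem abs_integral_sub_le {f g : UnitAddTorus (Fin d) → ℝ} (hf : Continuous f)
    (hg : Continuous g) {ε : ℝ} (h : ∀ x, |f x - g x| ≤ ε) :
    |∫ x, f x ∂torusMeasure d - ∫ x, g x ∂torusMeasure d| ≤ ε := by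
  rw [← integral_sub (integrable_of_continuous hf) (integrable_of_continuous hg)]
  simpa using norm_integral_le_of_norm_le_const (μ := torusMeasure d)
    (f := fun x => f x - g x) (Eventually.of_forall h)

/-- Dividing a representative of `s i` in `[0, 1)` by the dilation factor gives a small shift that
the dilation turns into `s`, except in coordinates of weight zero, which are not stretched. -/
theorem exists_shift (Λ : Fin d → ℕ) (n : ℕ) (s : UnitAddTorus (Fin d)) :
    ∃ t s' : UnitAddTorus (Fin d), ‖t‖ ≤ (n + 1 : ℝ)⁻¹ ∧ dilate Λ n t = s + s' ∧
      ∀ i, Λ i ≠ 0 → s' i = 0 := by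
  have h (i : Fin d) : ∃ r : ℝ, |r| ≤ 1 ∧ (r : UnitAddCircle) = s i :=
    ⟨AddCircle.equivIco 1 0 (s i), by
      have := (AddCircle.equivIco 1 0 (s i)).2
      rw [abs_le]; constructor <;> linarith [this.1, this.2], AddCircle.coe_equivIco⟩
  choose r hr hrs using h
  refine ⟨fun i => if Λ i = 0 then 0 else ((r i / (n + 1) ^ Λ i : ℝ) : UnitAddCircle),
    fun i => if Λ i = 0 then - s i else 0, ?_, ?_, fun i hi => by simp [hi]⟩
  · refine (pi_norm_le_iff_of_nonneg (by positivity)).2 fun i => ?_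
    split_ifs with hi
    · simp; positivity
    · refine (QuotientAddGroup.norm_mk_le_norm).trans ?_
      rw [Real.norm_eq_abs, abs_div, abs_of_pos (by positivity : (0 : ℝ) < (n + 1) ^ Λ i),
        inv_eq_one_div]
      have : (n + 1 : ℝ) ≤ (n + 1) ^ Λ i := le_self_pow₀ (by simp) hi
      gcongr
      exact hr i
  · ext i
    by_cases hi : Λ i = 0
    · simp [dilate, hi]
    · have : r i = ((n + 1) ^ Λ i : ℕ) • (r i / (n + 1) ^ Λ i) := by
        have : (n + 1 : ℝ) ≠ 0 := by positivity
        simp; field_simp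
      simp only [dilate, hi, if_false, Pi.add_apply, add_zero]
      rw [← hrs i, this, AddCircle.coe_nsmul]
      simp only [nsmul_eq_mul]
      congr 3
      have : (n + 1 : ℝ) ≠ 0 := by positivity
      push_cast
      field_simp

/-- **Fejér's lemma**: the variables `x` and `dilate Λ n x` become asymptotically independent. -/
theorem tendsto_integral_comp_dilate (Λ : Fin d → ℕ)
    {F : UnitAddTorus (Fin d) → UnitAddTorus (Fin d) → ℝ}
    (hF : Continuous fun p : UnitAddTorus (Fin d) × UnitAddTorus (Fin d) => F p.1 p.2)
    (hind : ∀ x, IndepOf {i | Λ i = 0} (F x)) :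
    Tendsto (fun n => ∫ x, F x (dilate Λ n x) ∂torusMeasure d) atTop
      (𝓝 (∫ x, ∫ y, F x y ∂torusMeasure d ∂torusMeasure d)) := by
  have hFn {a b : UnitAddTorus (Fin d) → UnitAddTorus (Fin d)} (ha : Continuous a)
      (hb : Continuous b) : Continuous fun x => F (a x) (b x) := hF.comp (ha.prodMk hb)
  rw [Metric.tendsto_atTop]
  intro ε hε
  obtain ⟨δ, hδ, H⟩ := Metric.uniformContinuous_iff.1
    (CompactSpace.uniformContinuous_of_continuous hF) (ε / 2) (half_pos hε)
  obtain ⟨N, hN⟩ := exists_nat_one_div_lt hδ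
  refine ⟨N, fun n hn => ?_⟩
  have hnδ : (n + 1 : ℝ)⁻¹ < δ := by
    rw [← one_div]
    exact (one_div_le_one_div_of_le (by positivity) (by gcongr)).trans_lt hN
  set I := ∫ x, F x (dilate Λ n x) ∂torusMeasure d
  -- Translation by the small `t` preserves the integral, barely moves the first argument, and moves
  -- the second by `s`. Averaging over all `s` then makes the second argument independent of the
  -- first.
  have key (s : UnitAddTorus (Fin d)) :
      |I - ∫ x, F x (dilate Λ n x + s) ∂torusMeasure d| ≤ ε / 2 := by
    obtain ⟨t, s', ht, hts, hs'⟩ := exists_shift Λ n s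
    have hI : I = ∫ x, F (x + t) (dilate Λ n x + s) ∂torusMeasure d := by
      refine (integral_add_right_eq_self (μ := torusMeasure d)
        (fun x => F x (dilate Λ n x)) t).symm.trans ?_
      refine integral_congr_ae (Eventually.of_forall fun x => ?_)
      dsimp only
      rw [dilate_add, hts, ← add_assoc]
      exact hind _ _ _ fun i hi => hs' i hi
    rw [hI]
    refine abs_integral_sub_le (hFn (by fun_prop) ((continuous_dilate Λ n).add continuous_const))
      (hFn continuous_id ((continuous_dilate Λ n).add continuous_const)) fun x => ?_
    have := @H (x + t, dilate Λ n x + s) (x, dilate Λ n x + s) (by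
      simpa [Prod.dist_eq, dist_eq_norm, hδ] using ht.trans_lt hnδ)
    exact (Real.dist_eq _ _ ▸ this).le
  have hcont : Continuous fun p : UnitAddTorus (Fin d) × UnitAddTorus (Fin d) =>
      F p.1 (dilate Λ n p.1 + p.2) :=
    hF.comp (continuous_fst.prodMk (((continuous_dilate Λ n).comp continuous_fst).add
      continuous_snd))
  have hint : Integrable (fun p : UnitAddTorus (Fin d) × UnitAddTorus (Fin d) =>
      F p.1 (dilate Λ n p.1 + p.2)) ((torusMeasure d).prod (torusMeasure d)) :=
    hcont.integrable_of_hasCompactSupport (HasCompactSupport.of_compactSpace _)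
  have hswap : ∫ s, ∫ x, F x (dilate Λ n x + s) ∂torusMeasure d ∂torusMeasure d =
      ∫ x, ∫ y, F x y ∂torusMeasure d ∂torusMeasure d := by
    rw [← integral_integral_swap hint]
    refine integral_congr_ae (Eventually.of_forall fun x => ?_)
    exact integral_add_left_eq_self (μ := torusMeasure d) (fun y => F x y) (dilate Λ n x)
  rw [Real.dist_eq, ← hswap]
  have hIc : I = ∫ _ : UnitAddTorus (Fin d), I ∂torusMeasure d := by simp
  rw [hIc, ← integral_sub (integrable_const I) hint.integral_prod_right]
  refine lt_of_le_of_lt ?_ (half_lt_self hε)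
  simpa using norm_integral_le_of_norm_le_const (μ := torusMeasure d)
    (f := fun s => I - ∫ x, F x (dilate Λ n x + s) ∂torusMeasure d) (Eventually.of_forall key)

/-! ### Smooth functions on the circle -/

/-- Smoothness of a function on the circle, in terms of its periodic lift. -/
def CircleSmooth (u : UnitAddCircle → ℝ) : Prop := ContDiff ℝ ∞ fun t : ℝ => u t

/-- The derivative of a function on the circle. -/
def circleDeriv (u : UnitAddCircle → ℝ) : UnitAddCircle → ℝ :=
  fun θ => deriv (fun t : ℝ => u (θ + t)) 0

/-- The normalized Haar measure of the circle. -/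
abbrev circleMeasure : Measure UnitAddCircle := AddCircle.haarAddCircle (T := 1)

theorem CircleSmooth.continuous {u : UnitAddCircle → ℝ} (hu : CircleSmooth u) : Continuous u :=
  QuotientAddGroup.isOpenQuotientMap_mk.isQuotientMap.continuous_iff.2 (ContDiff.continuous hu)

theorem circleDeriv_coe (u : UnitAddCircle → ℝ) (t : ℝ) :
    circleDeriv u t = deriv (fun t : ℝ => u t) t := by
  simpa [circleDeriv] using deriv_comp_const_add (fun t : ℝ => u t) t 0

theorem CircleSmooth.circleDeriv {u : UnitAddCircle → ℝ} (hu : CircleSmooth u) :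
    CircleSmooth (circleDeriv u) := by
  have h : (fun t : ℝ => TorusDeriv.circleDeriv u t) = deriv fun t : ℝ => u t :=
    funext (circleDeriv_coe u)
  change ContDiff ℝ ∞ fun t : ℝ => TorusDeriv.circleDeriv u t
  rw [h]
  exact (contDiff_infty_iff_deriv.1 hu).2

theorem CircleSmooth.iterate_circleDeriv {u : UnitAddCircle → ℝ} (hu : CircleSmooth u) (k : ℕ) :
    CircleSmooth (TorusDeriv.circleDeriv^[k] u) := by
  induction k with
  | zero => exact hu
  | succ k ih => rw [Function.iterate_succ_apply']; exact ih.circleDeriv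

theorem circleDeriv_const_mul (c : ℝ) (u : UnitAddCircle → ℝ) :
    circleDeriv (fun θ => c * u θ) = fun θ => c * circleDeriv u θ :=
  funext fun _ => deriv_const_mul_field _

theorem iterate_circleDeriv_const_mul (c : ℝ) (u : UnitAddCircle → ℝ) (k : ℕ) :
    circleDeriv^[k] (fun θ => c * u θ) = fun θ => c * circleDeriv^[k] u θ := by
  induction k with
  | zero => rfl
  | succ k ih => simp only [Function.iterate_succ_apply', ih, circleDeriv_const_mul]

theorem integrable_circle {u : UnitAddCircle → ℝ} (hu : Continuous u) :
    Integrable u circleMeasure :=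
  hu.integrable_of_hasCompactSupport (HasCompactSupport.of_compactSpace u)

theorem integral_circle_pos {u : UnitAddCircle → ℝ} (hu : Continuous u) (h0 : ∀ θ, 0 ≤ u θ)
    {θ : UnitAddCircle} (hθ : u θ ≠ 0) : 0 < ∫ θ, u θ ∂circleMeasure :=
  hu.integral_pos_of_hasCompactSupport_nonneg_nonzero (HasCompactSupport.of_compactSpace u) h0 hθ

theorem intervalIntegral_eq_integral_circle (u : UnitAddCircle → ℝ) (t : ℝ) :
    ∫ s in t..t + 1, u s = ∫ θ, u θ ∂circleMeasure := by
  rw [UnitAddCircle.intervalIntegral_preimage, AddCircle.volume_eq_smul_haarAddCircle]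
  simp

/-- The primitive is periodic because `v` has mean zero; subtracting its mean allows the
construction to be iterated. -/
theorem exists_circleDeriv_eq {v : UnitAddCircle → ℝ} (hv : CircleSmooth v)
    (h0 : ∫ θ, v θ ∂circleMeasure = 0) :
    ∃ u, CircleSmooth u ∧ ∫ θ, u θ ∂circleMeasure = 0 ∧ circleDeriv u = v := by
  have hvc : Continuous fun t : ℝ => v t := ContDiff.continuous hv
  let V : ℝ → ℝ := fun t => ∫ s in (0 : ℝ)..t, v s
  have hper : Function.Periodic V 1 := fun t => by
    have := intervalIntegral.integral_add_adjacent_intervals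
      (hvc.intervalIntegrable (μ := volume) 0 t) (hvc.intervalIntegrable t (t + 1))
    rw [intervalIntegral_eq_integral_circle, h0, add_zero] at this
    exact this.symm
  have hV (t : ℝ) : HasDerivAt V (v t) t := hvc.integral_hasStrictDerivAt 0 t |>.hasDerivAt
  let c := ∫ θ, hper.lift θ ∂circleMeasure
  have hderiv : deriv (fun t : ℝ => hper.lift (t : UnitAddCircle) - c) = fun t : ℝ => v t :=
    funext fun t => ((hV t).sub_const c).deriv
  have hsm : CircleSmooth fun θ => hper.lift θ - c := by
    refine contDiff_infty_iff_deriv.2 ⟨fun t => ((hV t).sub_const c).differentiableAt, ?_⟩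
    rw [hderiv]
    exact hv
  refine ⟨fun θ => hper.lift θ - c, hsm, ?_, ?_⟩
  · have hl : Continuous fun θ => hper.lift θ := by simpa using hsm.continuous.add_const c
    rw [integral_sub (integrable_circle hl) (integrable_const c)]
    simp [c]
  · ext θ
    obtain ⟨t, rfl⟩ := QuotientAddGroup.mk_surjective θ
    exact (circleDeriv_coe _ t).trans (congrFun hderiv t)

theorem exists_iterate_circleDeriv_eq {v : UnitAddCircle → ℝ} (hv : CircleSmooth v)
    (h0 : ∫ θ, v θ ∂circleMeasure = 0) (k : ℕ) :
    ∃ u, CircleSmooth u ∧ circleDeriv^[k] u = v := by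
  suffices ∃ u, CircleSmooth u ∧ ∫ θ, u θ ∂circleMeasure = 0 ∧ circleDeriv^[k] u = v by
    obtain ⟨u, hu, -, h⟩ := this
    exact ⟨u, hu, h⟩
  induction k with
  | zero => exact ⟨v, hv, h0, rfl⟩
  | succ k ih =>
    obtain ⟨u, hu, hu0, h⟩ := ih
    obtain ⟨u', hu', hu0', h'⟩ := exists_circleDeriv_eq hu hu0
    exact ⟨u', hu', hu0', by rw [Function.iterate_succ_apply, h', h]⟩

/-- The function `t ↦ cos (2π t + c)` on the circle. -/
def cosWave (c : ℝ) : UnitAddCircle → ℝ :=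
  Function.Periodic.lift (f := fun t : ℝ => Real.cos (2 * Real.pi * t + c)) (c := 1) fun t => by
    simp only [mul_add, mul_one, add_right_comm _ (2 * Real.pi) c, Real.cos_add_two_pi]

theorem cosWave_coe (c t : ℝ) : cosWave c (t : UnitAddCircle) = Real.cos (2 * Real.pi * t + c) :=
  rfl

theorem abs_cosWave_le (c : ℝ) (θ : UnitAddCircle) : |cosWave c θ| ≤ 1 := by
  obtain ⟨t, rfl⟩ := QuotientAddGroup.mk_surjective θ
  exact Real.abs_cos_le_one _

theorem circleSmooth_cosWave (c : ℝ) : CircleSmooth (cosWave c) := by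
  change ContDiff ℝ ∞ fun t : ℝ => Real.cos (2 * Real.pi * t + c)
  fun_prop

theorem circleDeriv_cosWave (c : ℝ) :
    circleDeriv (cosWave c) = fun θ => 2 * Real.pi * cosWave (c + Real.pi / 2) θ := by
  ext θ
  obtain ⟨t, rfl⟩ := QuotientAddGroup.mk_surjective θ
  refine (circleDeriv_coe _ t).trans ?_
  have h : HasDerivAt (fun t : ℝ => Real.cos (2 * Real.pi * t + c))
      (-Real.sin (2 * Real.pi * t + c) * (2 * Real.pi * 1)) t :=
    (((hasDerivAt_id t).const_mul (2 * Real.pi)).add_const c).cos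
  refine h.deriv.trans ?_
  change _ = 2 * Real.pi * Real.cos (2 * Real.pi * t + (c + Real.pi / 2))
  rw [← add_assoc, Real.cos_add_pi_div_two]
  ring

theorem iterate_circleDeriv_cosWave (c : ℝ) (k : ℕ) :
    circleDeriv^[k] (cosWave c) =
      fun θ => (2 * Real.pi) ^ k * cosWave (c + k * (Real.pi / 2)) θ := by
  induction k with
  | zero => simp
  | succ k ih =>
    rw [Function.iterate_succ_apply', ih, circleDeriv_const_mul, circleDeriv_cosWave]
    ext θ
    rw [pow_succ, mul_assoc]
    push_cast
    ring_nf

theorem cosWave_add_half (c : ℝ) (θ : UnitAddCircle) :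
    cosWave c (θ + ((1 / 2 : ℝ) : UnitAddCircle)) = -cosWave c θ := by
  obtain ⟨t, rfl⟩ := QuotientAddGroup.mk_surjective θ
  change Real.cos (2 * Real.pi * (t + 1 / 2) + c) = -Real.cos (2 * Real.pi * t + c)
  rw [← Real.cos_add_pi]
  ring_nf

theorem integral_cosWave (c : ℝ) : ∫ θ, cosWave c θ ∂circleMeasure = 0 := by
  have h := integral_add_right_eq_self (μ := circleMeasure) (cosWave c) ((1 / 2 : ℝ) : UnitAddCircle)
  simp only [cosWave_add_half, integral_neg] at h
  linarith

/-- A profile whose `k`-th derivative is a cosine, all of whose derivatives are nonzero. -/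
theorem exists_cos_profile (k l : ℕ) : ∃ u : UnitAddCircle → ℝ, CircleSmooth u ∧
    (∀ θ, 0 ≤ 1 + circleDeriv^[k] u θ) ∧ ∫ θ, circleDeriv^[k] u θ ∂circleMeasure = 0 ∧
    ∫ θ, circleDeriv^[l] u θ ∂circleMeasure = 0 ∧
    0 < ∫ θ, |circleDeriv^[l] u θ| ∂circleMeasure := by
  have hpi := Real.pi_pos
  -- The phase and the factor are chosen so that the `k`-th derivative is exactly the cosine with
  -- zero phase.
  have hD (j : ℕ) : circleDeriv^[j]
      (fun θ => ((2 * Real.pi) ^ k)⁻¹ * cosWave (-(k * (Real.pi / 2))) θ) =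
      fun θ => ((2 * Real.pi) ^ k)⁻¹ * ((2 * Real.pi) ^ j *
        cosWave (-(k * (Real.pi / 2)) + j * (Real.pi / 2)) θ) := by
    rw [iterate_circleDeriv_const_mul, iterate_circleDeriv_cosWave]
  refine ⟨fun θ => ((2 * Real.pi) ^ k)⁻¹ * cosWave (-(k * (Real.pi / 2))) θ,
    (contDiff_const (c := ((2 * Real.pi) ^ k)⁻¹)).mul
    (circleSmooth_cosWave (-(k * (Real.pi / 2)))), fun θ => ?_, ?_, ?_, ?_⟩
  · rw [hD]
    dsimp only
    rw [inv_mul_cancel_left₀ (by positivity)]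
    linarith [(abs_le.1 (abs_cosWave_le (-(k * (Real.pi / 2)) + k * (Real.pi / 2)) θ)).1]
  · simp only [hD, integral_const_mul, integral_cosWave, mul_zero]
  · simp only [hD, integral_const_mul, integral_cosWave, mul_zero]
  · rw [hD]
    set c := -(k * (Real.pi / 2)) + l * (Real.pi / 2)
    refine integral_circle_pos (θ := ((-c / (2 * Real.pi) : ℝ) : UnitAddCircle))
      (continuous_const.mul (continuous_const.mul (circleSmooth_cosWave c).continuous)).abs
      (fun _ => abs_nonneg _) ?_
    have : 2 * Real.pi * (-c / (2 * Real.pi)) + c = 0 := by field_simp; ring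
    simp only [cosWave_coe, this, Real.cos_zero]
    positivity

/-- A profile whose `k`-th derivative is `-1 + b` with a density `b` vanishing on the support of a
cutoff function. -/
theorem exists_bump_profile (k : ℕ) : ∃ u z : UnitAddCircle → ℝ, CircleSmooth u ∧ Continuous z ∧
    (∀ θ, 0 ≤ 1 + circleDeriv^[k] u θ) ∧ ∫ θ, circleDeriv^[k] u θ ∂circleMeasure = 0 ∧
    (∀ θ, 0 ≤ z θ ∧ z θ ≤ 1) ∧ 0 < ∫ θ, z θ ∂circleMeasure ∧
    ∀ θ, z θ * (1 + circleDeriv^[k] u θ) = 0 := by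
  let b : UnitAddCircle → ℝ := fun θ => Real.smoothTransition (cosWave 0 θ)
  have hb : CircleSmooth b := Real.smoothTransition.contDiff.comp (circleSmooth_cosWave 0)
  have hpos : 0 < ∫ θ, b θ ∂circleMeasure := by
    refine integral_circle_pos (θ := ((0 : ℝ) : UnitAddCircle)) hb.continuous
      (fun _ => Real.smoothTransition.nonneg _) ?_
    simp only [b, cosWave_coe, mul_zero, zero_add, Real.cos_zero]
    simp [Real.smoothTransition.one]
  set p := ∫ θ, b θ ∂circleMeasure
  have hv : CircleSmooth fun θ => p⁻¹ * b θ - 1 := (contDiff_const.mul hb).sub contDiff_const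
  have hv0 : ∫ θ, (p⁻¹ * b θ - 1) ∂circleMeasure = 0 := by
    rw [integral_sub ((integrable_circle hb.continuous).const_mul _) (integrable_const _),
      integral_const_mul]
    simp [p, inv_mul_cancel₀ hpos.ne']
  obtain ⟨u, hu, h⟩ := exists_iterate_circleDeriv_eq hv hv0 k
  -- The cutoff lives where the cosine is negative and `b` where it is positive, so their product
  -- vanishes; being a half-period translate of `b`, the cutoff has the same positive integral.
  have hz : (fun θ => Real.smoothTransition (-cosWave 0 θ)) =
      fun θ => b (θ + ((1 / 2 : ℝ) : UnitAddCircle)) := by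
    ext θ; simp only [b, cosWave_add_half]
  refine ⟨u, fun θ => Real.smoothTransition (-cosWave 0 θ), hu, ?_, fun θ => ?_, ?_, fun θ =>
    ⟨Real.smoothTransition.nonneg _, Real.smoothTransition.le_one _⟩, ?_, fun θ => ?_⟩
  · exact Real.smoothTransition.continuous.comp (circleSmooth_cosWave 0).continuous.neg
  · have : 0 ≤ b θ := Real.smoothTransition.nonneg _
    rw [h]
    have : 0 ≤ p⁻¹ * b θ := by positivity
    linarith
  · rw [h]; exact hv0
  · rw [hz, integral_add_right_eq_self (μ := circleMeasure) b]
    exact hpos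
  · rw [h]
    simp only [add_sub_cancel, b]
    rcases le_total (cosWave 0 θ) 0 with h | h
    · simp [Real.smoothTransition.zero_of_nonpos h]
    · simp [Real.smoothTransition.zero_of_nonpos (neg_nonpos.2 h)]

/-! ### Ridge functions -/

/-- The ridge function `x ↦ u(∑ a_i x_i)`. -/
def ridge (a : Fin d → ℕ) (u : UnitAddCircle → ℝ) (x : UnitAddTorus (Fin d)) : ℝ :=
  u (∑ i, a i • x i)

theorem continuous_ridge (a : Fin d → ℕ) {u : UnitAddCircle → ℝ} (hu : Continuous u) :
    Continuous (ridge a u) := by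
  unfold ridge; fun_prop

theorem isSmooth_ridge (a : Fin d → ℕ) {u : UnitAddCircle → ℝ} (hu : CircleSmooth u) :
    IsSmooth (ridge a u) := by
  have h : (fun x : Fin d → ℝ => ridge a u (toTorus x)) =
      (fun t : ℝ => u t) ∘ fun x => ∑ i, a i • x i := by
    ext x
    simp only [Function.comp, ridge, toTorus]
    congr 1
    exact (map_sum (QuotientAddGroup.mk' (AddSubgroup.zmultiples (1 : ℝ)))
      (fun i => a i • x i) Finset.univ).symm
  change ContDiff ℝ ∞ fun x : Fin d → ℝ => ridge a u (toTorus x)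
  rw [h]
  exact ContDiff.comp (g := fun t : ℝ => u t) hu (by fun_prop)

theorem indepOf_ridge {S : Set (Fin d)} {a : Fin d → ℕ} (ha : ∀ i ∈ S, a i = 0)
    (u : UnitAddCircle → ℝ) : IndepOf S (ridge a u) := fun x s hs => by
  unfold ridge
  congr 1
  refine Finset.sum_congr rfl fun i _ => ?_
  by_cases hi : i ∈ S
  · simp [ha i hi]
  · simp [hs i hi]

theorem partialDeriv_ridge (a : Fin d → ℕ) (u : UnitAddCircle → ℝ) (i : Fin d) :
    partialDeriv i (ridge a u) = fun x => a i * ridge a (circleDeriv u) x := by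
  ext x
  have h (t : ℝ) : ∑ j, a j • (x + Pi.single i (t : UnitAddCircle) : UnitAddTorus (Fin d)) j =
      ∑ j, a j • x j + ((a i * t : ℝ) : UnitAddCircle) := by
    simp only [Pi.add_apply, smul_add, Finset.sum_add_distrib, add_right_inj]
    rw [Finset.sum_eq_single i (fun j _ hj => by simp [hj]) (by simp), Pi.single_eq_same,
      ← nsmul_eq_mul]
    rfl
  simp only [partialDeriv, ridge, h]
  simpa [circleDeriv] using deriv_comp_mul_left (a i : ℝ)
    (fun t : ℝ => u (∑ j, a j • x j + (t : UnitAddCircle))) 0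

theorem wordDeriv_ridge (a : Fin d → ℕ) (u : UnitAddCircle → ℝ) (w : List (Fin d)) :
    wordDeriv w (ridge a u) =
      fun x => (w.map fun i => (a i : ℝ)).prod * ridge a (circleDeriv^[w.length] u) x := by
  induction w with
  | nil => simp
  | cons i w ih =>
    rw [wordDeriv_cons, ih, partialDeriv_const_mul, partialDeriv_ridge]
    ext x
    simp only [List.map_cons, List.prod_cons, List.length_cons, Function.iterate_succ_apply']
    ring

/-- The linear form is a continuous surjective homomorphism, hence carries Haar measure to Haar
measure. -/
theorem integral_ridge {a : Fin d → ℕ} {i : Fin d} (ha : a i ≠ 0) {u : UnitAddCircle → ℝ}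
    (hu : Continuous u) : ∫ x, ridge a u x ∂torusMeasure d = ∫ θ, u θ ∂circleMeasure := by
  let φ : UnitAddTorus (Fin d) →+ UnitAddCircle :=
    ∑ i, a i • Pi.evalAddMonoidHom (fun _ : Fin d => UnitAddCircle) i
  have hφ (x) : φ x = ∑ i, a i • x i := by simp [φ]
  have hcont : Continuous φ := by
    have : (φ : UnitAddTorus (Fin d) → UnitAddCircle) = fun x => ∑ i, a i • x i := funext hφ
    rw [this]; fun_prop
  have hsurj : Function.Surjective φ := fun θ => by
    obtain ⟨t, rfl⟩ := QuotientAddGroup.mk_surjective θ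
    refine ⟨Pi.single i ((t / a i : ℝ) : UnitAddCircle), ?_⟩
    rw [hφ, Finset.sum_eq_single i (fun j _ hj => by simp [hj]) (by simp), Pi.single_eq_same,
      ← AddCircle.coe_nsmul, nsmul_eq_mul, mul_div_cancel₀ _ (Nat.cast_ne_zero.2 ha)]
  have hmp : MeasurePreserving φ (torusMeasure d) circleMeasure :=
    φ.measurePreserving hcont hsurj (by simp)
  rw [← hmp.map_eq, integral_map hcont.measurable.aemeasurable hu.aestronglyMeasurable]
  simp only [hφ, ridge]

/-! ### Ridge functions with prescribed sizes of derivatives -/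

/-- The frequency vector with entries `M ^ ((∑ Γ) Λ_i - Γ_i)` where `Λ_i ≠ 0`. -/
def frequency (Λ Γ : Fin d → ℕ) (M : ℕ) (i : Fin d) : ℕ :=
  if Λ i = 0 then 0 else M ^ ((∑ j, Γ j) * Λ i - Γ i)

/-- The exponents add up to `(∑ Γ) Λ(w) - Γ(w)`, so among words of equal `Λ`-weight the size is
governed by `Γ(w)` alone. -/
theorem prod_frequency_mul (Λ Γ : Fin d → ℕ) (M : ℕ) {w : List (Fin d)}
    (hw : ∀ i ∈ w, Λ i ≠ 0) :
    (w.map fun i => (frequency Λ Γ M i : ℝ)).prod * (M : ℝ) ^ (w.map Γ).sum =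
      (M : ℝ) ^ ((∑ j, Γ j) * (w.map Λ).sum) := by
  induction w with
  | nil => simp
  | cons i w ih =>
    have hi : Λ i ≠ 0 := hw i List.mem_cons_self
    -- This makes the truncated subtraction in `frequency` a true one.
    have hle : Γ i ≤ (∑ j, Γ j) * Λ i :=
      (Finset.single_le_sum (f := Γ) (fun _ _ => Nat.zero_le _) (Finset.mem_univ i)).trans
        (Nat.le_mul_of_pos_right _ (Nat.pos_of_ne_zero hi))
    have h : (frequency Λ Γ M i : ℝ) * (M : ℝ) ^ Γ i = (M : ℝ) ^ ((∑ j, Γ j) * Λ i) := by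
      rw [frequency, if_neg hi, Nat.cast_pow, ← pow_add, Nat.sub_add_cancel hle]
    simp only [List.map_cons, List.prod_cons, List.sum_cons, pow_add, mul_add]
    rw [← ih fun j hj => hw j (List.mem_cons_of_mem _ hj), ← h]
    ring

/-- The ridge function is divided by its coefficient along `w₀`; the coefficient along another word
is then a ratio, computed by `prod_frequency_mul`. -/
theorem exists_block (Λ Γ : Fin d → ℕ) {M : ℕ} (hM : M ≠ 0) {w₀ : List (Fin d)}
    (hw₀ : ∀ i ∈ w₀, Λ i ≠ 0) {u : UnitAddCircle → ℝ} (hu : CircleSmooth u) :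
    ∃ h : UnitAddTorus (Fin d) → ℝ, IsSmooth h ∧ IndepOf {i | Λ i = 0} h ∧
      ∀ w : List (Fin d), (∀ i ∈ w, Λ i ≠ 0) → (w.map Λ).sum = (w₀.map Λ).sum →
        ∀ e : ℕ, (w.map Γ).sum = (w₀.map Γ).sum + e → wordDeriv w h = fun x =>
          ((M : ℝ) ^ e)⁻¹ * ridge (frequency Λ Γ M) (circleDeriv^[w.length] u) x := by
  have hind : IndepOf {i | Λ i = 0} (ridge (frequency Λ Γ M) u) :=
    indepOf_ridge (fun i hi => if_pos hi) u
  refine ⟨fun x => ((w₀.map fun i => (frequency Λ Γ M i : ℝ)).prod)⁻¹ *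
    ridge (frequency Λ Γ M) u x, (isSmooth_ridge _ hu).const_mul _,
    (indepOf_const _ _).mul hind, fun w hw hΛ e hΓ => ?_⟩
  rw [wordDeriv_const_mul, wordDeriv_ridge]
  ext x
  have h₀ := prod_frequency_mul Λ Γ M hw₀
  have h₁ := prod_frequency_mul Λ Γ M hw
  have hM' : (M : ℝ) ≠ 0 := Nat.cast_ne_zero.2 hM
  rw [hΛ, ← h₀, hΓ, pow_add, mul_left_comm] at h₁
  have h₂ := mul_left_cancel₀ (pow_ne_zero _ hM') (h₁.trans (mul_comm _ _))
  have h₃ : (w₀.map fun i => (frequency Λ Γ M i : ℝ)).prod ≠ 0 := fun h => by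
    rw [h, zero_mul] at h₀
    exact pow_ne_zero _ hM' h₀.symm
  rw [← mul_assoc, ← h₂]
  congr 1
  rw [← h₂] at h₃
  field_simp [left_ne_zero_of_mul h₃]

/-! ### Superposition of a function with a rapidly oscillating copy of another -/

/-- The function `h + (n + 1)^{-c} g · f(dilate Λ n ·)`. -/
def superpose (Λ : Fin d → ℕ) (c : ℕ) (h g f : UnitAddTorus (Fin d) → ℝ) (n : ℕ) :
    UnitAddTorus (Fin d) → ℝ :=
  fun x => h x + ((n + 1 : ℝ) ^ c)⁻¹ * (g x * f (dilate Λ n x))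

section Superpose

variable {Λ : Fin d → ℕ} {h g f : UnitAddTorus (Fin d) → ℝ}

theorem isSmooth_superpose (c : ℕ) (hh : IsSmooth h) (hg : IsSmooth g) (hf : IsSmooth f) (n : ℕ) :
    IsSmooth (superpose Λ c h g f n) :=
  hh.add ((hg.mul (hf.comp_dilate Λ n)).const_mul _)

theorem indepOf_superpose {S : Set (Fin d)} (c : ℕ) (hh : IndepOf S h) (hg : IndepOf S g)
    (hf : IndepOf S f) (n : ℕ) : IndepOf S (superpose Λ c h g f n) :=
  hh.add ((indepOf_const S _).mul (hg.mul (hf.comp_dilate Λ n)))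

theorem eventually_wordDeriv_superpose (hh : IsSmooth h) (hg : IsSmooth g) (hf : IsSmooth f)
    {w : List (Fin d)} (hw : ∀ i ∈ w, Λ i ≠ 0) {ε : ℝ} (hε : 0 < ε) :
    ∀ᶠ n in atTop, ∀ x, |wordDeriv w (superpose Λ (w.map Λ).sum h g f n) x -
      (wordDeriv w h x + g x * wordDeriv w f (dilate Λ n x))| ≤ ε := by
  obtain ⟨u, hu, H⟩ := negligible_wordDeriv_mul_comp_dilate hf hg hw
  filter_upwards [hu.eventually_le hε] with n hn x
  unfold superpose
  rw [wordDeriv_add hh ((hg.mul (hf.comp_dilate Λ n)).const_mul _), wordDeriv_const_mul]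
  dsimp only
  rw [H]
  convert hn x using 2
  ring

/-- The uniform approximation of the derivative reduces this to Fejér's lemma. The constant `r` is 1
when following `1 + D^{w₀} f` and 0 for the other words. -/
theorem tendsto_normL1_superpose (hh : IsSmooth h) (hg : IsSmooth g) (hf : IsSmooth f)
    (hfΛ : IndepOf {i | Λ i = 0} f) {w : List (Fin d)} (hw : ∀ i ∈ w, Λ i ≠ 0) (r : ℝ) :
    Tendsto (fun n => normL1 fun x => r + wordDeriv w (superpose Λ (w.map Λ).sum h g f n) x)
      atTop (𝓝 (∫ x, ∫ y, |r + (wordDeriv w h x + g x * wordDeriv w f y)|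
        ∂torusMeasure d ∂torusMeasure d)) := by
  have hh' := (hh.wordDeriv w).continuous
  have hf' := (hf.wordDeriv w).continuous
  have hg' := hg.continuous
  have hlim := tendsto_integral_comp_dilate Λ
    (F := fun x y => |r + (wordDeriv w h x + g x * wordDeriv w f y)|) (by fun_prop)
    fun x y s hs => by simp only [hfΛ.wordDeriv w y s hs]
  rw [Metric.tendsto_atTop'] at hlim ⊢
  intro ε hε
  obtain ⟨N, hN⟩ := hlim (ε / 2) (half_pos hε)
  obtain ⟨N', hN'⟩ := eventually_atTop.1
    (eventually_wordDeriv_superpose hh hg hf hw (half_pos hε))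
  refine ⟨max N N', fun n hn => ?_⟩
  have h₁ := hN n ((le_max_left _ _).trans_lt hn)
  have hcs := ((isSmooth_superpose (Λ := Λ) (w.map Λ).sum hh hg hf n).wordDeriv w).continuous
  have hcd := continuous_dilate Λ n
  have h₂ := abs_integral_sub_le
    (f := fun x => |r + wordDeriv w (superpose Λ (w.map Λ).sum h g f n) x|)
    (g := fun x => |r + (wordDeriv w h x + g x * wordDeriv w f (dilate Λ n x))|)
    (by fun_prop) (by fun_prop) (ε := ε / 2) fun x => by
      refine (abs_abs_sub_abs_le_abs_sub _ _).trans ?_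
      rw [add_sub_add_left_eq_sub]
      exact hN' n ((le_max_right _ _).trans hn.le) x
  rw [Real.dist_eq] at h₁ ⊢
  have := abs_sub_le (normL1 fun x => r + wordDeriv w (superpose Λ (w.map Λ).sum h g f n) x) _ _
    |>.trans_lt (add_lt_add_of_le_of_lt h₂ h₁)
  rwa [add_halves] at this

end Superpose

/-! ### Estimates for the limiting integrals -/

theorem integral_mono_of_continuous {f g : UnitAddTorus (Fin d) → ℝ} (hf : Continuous f)
    (hg : Continuous g) (h : ∀ x, f x ≤ g x) :
    ∫ x, f x ∂torusMeasure d ≤ ∫ x, g x ∂torusMeasure d :=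
  integral_mono (integrable_of_continuous hf) (integrable_of_continuous hg) h

theorem continuous_integral_right {F : UnitAddTorus (Fin d) → UnitAddTorus (Fin d) → ℝ}
    (hF : Continuous fun p : UnitAddTorus (Fin d) × UnitAddTorus (Fin d) => F p.1 p.2) :
    Continuous fun x => ∫ y, F x y ∂torusMeasure d :=
  (continuous_parametric_integral_of_continuous (μ := torusMeasure d) hF isCompact_univ).congr
    fun x => by simp

theorem integral_integral_mono {F G : UnitAddTorus (Fin d) → UnitAddTorus (Fin d) → ℝ}
    (hF : Continuous fun p : UnitAddTorus (Fin d) × UnitAddTorus (Fin d) => F p.1 p.2)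
    (hG : Continuous fun p : UnitAddTorus (Fin d) × UnitAddTorus (Fin d) => G p.1 p.2)
    (h : ∀ x y, F x y ≤ G x y) :
    ∫ x, ∫ y, F x y ∂torusMeasure d ∂torusMeasure d ≤
      ∫ x, ∫ y, G x y ∂torusMeasure d ∂torusMeasure d :=
  integral_mono_of_continuous (continuous_integral_right hF) (continuous_integral_right hG)
    fun x => integral_mono_of_continuous (hF.comp (by fun_prop : Continuous fun y => (x, y)))
      (hG.comp (by fun_prop : Continuous fun y => (x, y))) (h x)

theorem integral_integral_mul_add_const {g F : UnitAddTorus (Fin d) → ℝ} (hF : Continuous F)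
    (hg : Continuous g) (hg1 : ∫ x, g x ∂torusMeasure d = 1) (η : ℝ) :
    ∫ x, ∫ y, (g x * F y + η) ∂torusMeasure d ∂torusMeasure d =
      ∫ y, F y ∂torusMeasure d + η := by
  have h (x) : ∫ y, (g x * F y + η) ∂torusMeasure d = g x * ∫ y, F y ∂torusMeasure d + η := by
    rw [integral_add ((integrable_of_continuous hF).const_mul _) (integrable_const _),
      integral_const_mul]
    simp
  simp only [h]
  rw [integral_add ((integrable_of_continuous hg).mul_const _) (integrable_const _),
    integral_mul_const, hg1]
  simp

theorem integral_integral_abs_le {a g F : UnitAddTorus (Fin d) → ℝ} (ha : Continuous a)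
    (hg : Continuous g) (hF : Continuous F) (hg0 : ∀ x, 0 ≤ g x)
    (hg1 : ∫ x, g x ∂torusMeasure d = 1) {η : ℝ} (hη : ∀ x, |a x| ≤ η) :
    ∫ x, ∫ y, |a x + g x * F y| ∂torusMeasure d ∂torusMeasure d ≤ normL1 F + η := by
  rw [normL1, ← integral_integral_mul_add_const hF.abs hg hg1]
  refine integral_integral_mono (by fun_prop) (by fun_prop) fun x y => ?_
  have := abs_add_le (a x) (g x * F y)
  rw [abs_mul, abs_of_nonneg (hg0 x)] at this
  linarith [hη x]

theorem le_integral_integral_abs {a g F : UnitAddTorus (Fin d) → ℝ} (ha : Continuous a)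
    (hg : Continuous g) (hF : Continuous F) (hg0 : ∀ x, 0 ≤ g x)
    (hg1 : ∫ x, g x ∂torusMeasure d = 1) {η : ℝ} (hη : ∀ x, |a x| ≤ η) :
    normL1 F - η ≤ ∫ x, ∫ y, |a x + g x * F y| ∂torusMeasure d ∂torusMeasure d := by
  rw [normL1, sub_eq_add_neg, ← integral_integral_mul_add_const hF.abs hg hg1]
  refine integral_integral_mono (by fun_prop) (by fun_prop) fun x y => ?_
  have := abs_sub_abs_le_abs_sub (g x * F y) (-a x)
  rw [abs_mul, abs_of_nonneg (hg0 x), abs_neg, sub_neg_eq_add, add_comm (g x * F y)] at this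
  linarith [hη x]

/-- Two lower bounds are interpolated with weights `1 - z` and `z`: testing against the sign of `t`
gives `|t|`, since `a` has mean zero, and the triangle inequality gives `normL1 a - |t|`. -/
theorem le_integral_abs_add_mul {a g : UnitAddTorus (Fin d) → ℝ} (ha : Continuous a)
    (hg : Continuous g) (hg0 : ∀ x, 0 ≤ g x) (hg1 : ∫ x, g x ∂torusMeasure d = 1)
    (ha0 : ∫ x, a x ∂torusMeasure d = 0) (t : ℝ) {z : ℝ} (hz : 0 ≤ z) (hz1 : z ≤ 1) :
    |t| + z * normL1 a - 2 * |z * t| ≤ ∫ x, |a x + g x * t| ∂torusMeasure d := by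
  obtain ⟨σ, hσ, hσt⟩ : ∃ σ : ℝ, |σ| ≤ 1 ∧ σ * t = |t| := by
    rcases le_total 0 t with h | h
    · exact ⟨1, by simp, by simp [abs_of_nonneg h]⟩
    · exact ⟨-1, by simp, by simp [abs_of_nonpos h]⟩
  have key (x) : ((1 - 2 * z) * |t|) * g x + ((1 - z) * σ) * a x + z * |a x| ≤
      |a x + g x * t| := by
    have h₁ : σ * (a x + g x * t) ≤ |a x + g x * t| := by
      refine (le_abs_self _).trans ?_
      rw [abs_mul]
      exact mul_le_of_le_one_left (abs_nonneg _) hσ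
    have h₂ : |a x| - g x * |t| ≤ |a x + g x * t| := by
      have := abs_sub_abs_le_abs_sub (a x) (-(g x * t))
      rwa [abs_neg, abs_mul, abs_of_nonneg (hg0 x), sub_neg_eq_add] at this
    have h₃ := mul_le_mul_of_nonneg_left h₁ (sub_nonneg.2 hz1)
    have h₄ := mul_le_mul_of_nonneg_left h₂ hz
    have h₅ : σ * (a x + g x * t) = σ * a x + g x * |t| := by rw [← hσt]; ring
    rw [h₅] at h₃
    linarith
  have hint := integral_mono_of_continuous (by fun_prop) (by fun_prop) key
  rw [integral_add, integral_add, integral_const_mul, integral_const_mul, integral_const_mul,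
    hg1, ha0, abs_mul, abs_of_nonneg hz] at *
  · change _ + z * normL1 a ≤ _ at hint
    linarith
  all_goals exact integrable_of_continuous (by fun_prop)

/-- The previous bound is used for each `y` with `t = F y` and weight `z y`; where `z` lives `F` is
small, so the loss is at most `2 * η`. -/
theorem le_integral_integral_abs_of_cutoff {a g F z : UnitAddTorus (Fin d) → ℝ}
    (ha : Continuous a) (hg : Continuous g) (hF : Continuous F) (hz : Continuous z)
    (hg0 : ∀ x, 0 ≤ g x) (hg1 : ∫ x, g x ∂torusMeasure d = 1)
    (ha0 : ∫ x, a x ∂torusMeasure d = 0) (hz01 : ∀ x, 0 ≤ z x ∧ z x ≤ 1) {η : ℝ}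
    (hη : ∀ x, |z x * F x| ≤ η) :
    normL1 F + (∫ x, z x ∂torusMeasure d) * normL1 a - 2 * η ≤
      ∫ x, ∫ y, |a x + g x * F y| ∂torusMeasure d ∂torusMeasure d := by
  have hcont : Continuous fun p : UnitAddTorus (Fin d) × UnitAddTorus (Fin d) =>
      |a p.1 + g p.1 * F p.2| := by fun_prop
  rw [integral_integral_swap (hcont.integrable_of_hasCompactSupport
    (HasCompactSupport.of_compactSpace _))]
  have hswap : Continuous fun p : UnitAddTorus (Fin d) × UnitAddTorus (Fin d) =>
      |a p.2 + g p.2 * F p.1| := by fun_prop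
  have key (y) : |F y| + z y * normL1 a - 2 * η ≤ ∫ x, |a x + g x * F y| ∂torusMeasure d := by
    have := le_integral_abs_add_mul ha hg hg0 hg1 ha0 (F y) (hz01 y).1 (hz01 y).2
    linarith [hη y]
  refine le_trans (le_of_eq ?_)
    (integral_mono_of_continuous (by fun_prop) (continuous_integral_right hswap) key)
  rw [integral_sub, integral_add, integral_mul_const, normL1]
  · simp
  all_goals exact integrable_of_continuous (by fun_prop)

/-! ### The iterative construction -/

section Limits

variable {Λ : Fin d → ℕ} {h g f : UnitAddTorus (Fin d) → ℝ}

/-- Regrouping the limit as `(r + D^w h - r g) + g (r + D^w f)` isolates the error. For `w₀`, `r =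
1` and `g = 1 + D^{w₀} h` it is zero, so the norm does not drift. -/
theorem eventually_normL1_superpose_le (hh : IsSmooth h) (hg : IsSmooth g) (hf : IsSmooth f)
    (hfΛ : IndepOf {i | Λ i = 0} f) (hg0 : ∀ x, 0 ≤ g x) (hg1 : ∫ x, g x ∂torusMeasure d = 1)
    {w : List (Fin d)} (hw : ∀ i ∈ w, Λ i ≠ 0) {r η ε : ℝ}
    (hη : ∀ x, |r + wordDeriv w h x - r * g x| ≤ η) (hε : 0 < ε) :
    ∀ᶠ n in atTop, normL1 (fun x => r + wordDeriv w (superpose Λ (w.map Λ).sum h g f n) x) ≤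
      normL1 (fun x => r + wordDeriv w f x) + η + ε := by
  have hh' := (hh.wordDeriv w).continuous
  have hf' := (hf.wordDeriv w).continuous
  have hg' := hg.continuous
  have hle := integral_integral_abs_le (a := fun x => r + wordDeriv w h x - r * g x)
    (F := fun y => r + wordDeriv w f y) (by fun_prop) hg' (by fun_prop) hg0 hg1 hη
  have heq : ∀ x y, r + wordDeriv w h x - r * g x + g x * (r + wordDeriv w f y) =
      r + (wordDeriv w h x + g x * wordDeriv w f y) := fun x y => by ring
  simp only [heq] at hle
  filter_upwards [(tendsto_normL1_superpose hh hg hf hfΛ hw r).eventually_lt_const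
    (lt_of_le_of_lt hle (lt_add_of_pos_right _ hε))] with n hn using hn.le

theorem eventually_le_normL1_superpose (hh : IsSmooth h) (hg : IsSmooth g) (hf : IsSmooth f)
    (hfΛ : IndepOf {i | Λ i = 0} f) (hg0 : ∀ x, 0 ≤ g x) (hg1 : ∫ x, g x ∂torusMeasure d = 1)
    {w : List (Fin d)} (hw : ∀ i ∈ w, Λ i ≠ 0) {η ε : ℝ}
    (hη : ∀ x, |wordDeriv w h x| ≤ η) (hε : 0 < ε) :
    ∀ᶠ n in atTop, normL1 (wordDeriv w f) - η - ε ≤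
      normL1 (wordDeriv w (superpose Λ (w.map Λ).sum h g f n)) := by
  have hle := le_integral_integral_abs (hh.wordDeriv w).continuous hg.continuous
    (hf.wordDeriv w).continuous hg0 hg1 hη
  have hlim := tendsto_normL1_superpose hh hg hf hfΛ hw 0
  simp only [zero_add] at hlim
  filter_upwards [hlim.eventually_const_lt (lt_of_lt_of_le (sub_lt_self _ hε) hle)] with n hn
    using hn.le

theorem eventually_le_normL1_superpose_of_cutoff (hh : IsSmooth h) (hg : IsSmooth g)
    (hf : IsSmooth f) (hfΛ : IndepOf {i | Λ i = 0} f) (hg0 : ∀ x, 0 ≤ g x)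
    (hg1 : ∫ x, g x ∂torusMeasure d = 1) {w : List (Fin d)} (hw : ∀ i ∈ w, Λ i ≠ 0)
    (hw0 : ∫ x, wordDeriv w h x ∂torusMeasure d = 0) {z : UnitAddTorus (Fin d) → ℝ}
    (hz : Continuous z) (hz01 : ∀ x, 0 ≤ z x ∧ z x ≤ 1) {η ε : ℝ}
    (hη : ∀ x, |z x * wordDeriv w f x| ≤ η) (hε : 0 < ε) :
    ∀ᶠ n in atTop, normL1 (wordDeriv w f) +
      (∫ x, z x ∂torusMeasure d) * normL1 (wordDeriv w h) - 2 * η - ε ≤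
      normL1 (wordDeriv w (superpose Λ (w.map Λ).sum h g f n)) := by
  have hle := le_integral_integral_abs_of_cutoff (hh.wordDeriv w).continuous hg.continuous
    (hf.wordDeriv w).continuous hz hg0 hg1 hw0 hz01 hη
  have hlim := tendsto_normL1_superpose hh hg hf hfΛ hw 0
  simp only [zero_add] at hlim
  filter_upwards [hlim.eventually_const_lt (lt_of_lt_of_le (sub_lt_self _ hε) hle)] with n hn
    using hn.le

/-- Where `z` is nonzero `g` vanishes, leaving only the derivative of `h` and the approximation
error. -/
theorem eventually_cutoff_superpose_le (hh : IsSmooth h) (hg : IsSmooth g) (hf : IsSmooth f)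
    {w : List (Fin d)} (hw : ∀ i ∈ w, Λ i ≠ 0) {z : UnitAddTorus (Fin d) → ℝ}
    (hz01 : ∀ x, 0 ≤ z x ∧ z x ≤ 1) (hzg : ∀ x, z x * g x = 0) {η ε : ℝ}
    (hη : ∀ x, |wordDeriv w h x| ≤ η) (hε : 0 < ε) :
    ∀ᶠ n in atTop, ∀ x, |z x * wordDeriv w (superpose Λ (w.map Λ).sum h g f n) x| ≤ η + ε := by
  filter_upwards [eventually_wordDeriv_superpose hh hg hf hw hε] with n hn x
  set D := wordDeriv w (superpose Λ (w.map Λ).sum h g f n) x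
  set F := wordDeriv w f (dilate Λ n x)
  have h₁ : z x * D = z x * (D - (wordDeriv w h x + g x * F) + wordDeriv w h x) := by
    linear_combination F * hzg x
  rw [h₁, abs_mul, abs_of_nonneg (hz01 x).1]
  refine (mul_le_of_le_one_left (abs_nonneg _) (hz01 x).2).trans ((abs_add_le _ _).trans ?_)
  linarith [hn x, hη x]

end Limits

/-- Words `w₀`, `w₁`, `v j` of equal `Λ`-weight, in letters of positive `Λ`-weight, whose
`Γ`-weights satisfy `Γ(w₀) < Γ(w₁) < Γ(v j)`. -/
structure WordSystem (Λ Γ : Fin d → ℕ) {ι : Type*} (w₀ w₁ : List (Fin d))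
    (v : ι → List (Fin d)) : Prop where
  ne_zero₀ : ∀ i ∈ w₀, Λ i ≠ 0
  ne_zero₁ : ∀ i ∈ w₁, Λ i ≠ 0
  ne_zero : ∀ j, ∀ i ∈ v j, Λ i ≠ 0
  sum₁ : (w₁.map Λ).sum = (w₀.map Λ).sum
  sum : ∀ j, ((v j).map Λ).sum = (w₀.map Λ).sum
  lt₁ : (w₀.map Γ).sum < (w₁.map Γ).sum
  lt : ∀ j, (w₁.map Γ).sum < ((v j).map Γ).sum

theorem exists_circle_bound {u : UnitAddCircle → ℝ} (hu : CircleSmooth u) (N : ℕ) :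
    ∃ C : ℝ, 0 ≤ C ∧ ∀ k ≤ N, ∀ θ, |circleDeriv^[k] u θ| ≤ C := by
  have h (k : ℕ) := isCompact_univ.exists_bound_of_continuousOn
    (hu.iterate_circleDeriv k).continuous.continuousOn
  choose C hC using h
  have hC0 (k : ℕ) : 0 ≤ C k := (norm_nonneg _).trans (hC k 0 trivial)
  refine ⟨∑ k ∈ Finset.range (N + 1), C k, Finset.sum_nonneg fun k _ => hC0 k, fun k hk θ => ?_⟩
  exact (hC k θ trivial).trans (Finset.single_le_sum (f := C) (fun k _ => hC0 k)
    (Finset.mem_range.2 (Nat.lt_succ_of_le hk)))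

namespace WordSystem

variable {Λ Γ : Fin d → ℕ} {ι : Type*} {w₀ w₁ : List (Fin d)} {v : ι → List (Fin d)}

/-- `Γ`-weights are integers, so the strict inequality between `w₁` and `v j` yields a full extra
factor `1 / M`. -/
theorem exists_block (H : WordSystem Λ Γ w₀ w₁ v) {u : UnitAddCircle → ℝ} (hu : CircleSmooth u)
    {C : ℝ} (hC : ∀ j θ, |circleDeriv^[(v j).length] u θ| ≤ C) {M : ℕ}
    (hM : 1 ≤ M) : ∃ (a : Fin d → ℕ) (h : UnitAddTorus (Fin d) → ℝ), (∃ i, a i ≠ 0) ∧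
      IsSmooth h ∧ IndepOf {i | Λ i = 0} h ∧
      IndepOf {i | Λ i = 0} (ridge a (circleDeriv^[w₀.length] u)) ∧
      wordDeriv w₀ h = ridge a (circleDeriv^[w₀.length] u) ∧
      (wordDeriv w₁ h = fun x => ((M : ℝ) ^ ((w₁.map Γ).sum - (w₀.map Γ).sum))⁻¹ *
        ridge a (circleDeriv^[w₁.length] u) x) ∧
      ∀ j x, |wordDeriv (v j) h x| ≤
        ((M : ℝ) ^ ((w₁.map Γ).sum - (w₀.map Γ).sum + 1))⁻¹ * C := by
  obtain ⟨h, hh, hhΛ, hD⟩ := TorusDeriv.exists_block Λ Γ (by omega : M ≠ 0) H.ne_zero₀ hu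
  refine ⟨frequency Λ Γ M, h, ?_, hh, hhΛ, indepOf_ridge (fun i hi => if_pos hi) _, ?_, ?_,
    fun j x => ?_⟩
  -- The word `w₁` is nonempty because its `Γ`-weight is positive.
  · obtain ⟨i, hi⟩ := List.exists_mem_of_ne_nil w₁ (by
      rintro rfl
      exact absurd H.lt₁ (by simp))
    refine ⟨i, ?_⟩
    rw [frequency, if_neg (H.ne_zero₁ i hi)]
    exact pow_ne_zero _ (by omega)
  · simpa using hD w₀ H.ne_zero₀ rfl 0 rfl
  · exact hD w₁ H.ne_zero₁ H.sum₁ _ (by have := H.lt₁; omega)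
  · have h₀ := H.lt₁
    have h₁ := H.lt j
    rw [hD (v j) (H.ne_zero j) (H.sum j) (((v j).map Γ).sum - (w₀.map Γ).sum) (by omega), abs_mul,
      abs_of_nonneg (by positivity)]
    have hM' : (1 : ℝ) ≤ M := by exact_mod_cast hM
    have hle : (w₁.map Γ).sum - (w₀.map Γ).sum + 1 ≤ ((v j).map Γ).sum - (w₀.map Γ).sum := by
      omega
    gcongr
    exact hC j _

variable [Finite ι]

/-- One round of the construction keeps the norm of `1 + D^{w₀} f` and increases the norm of
`D^{w₁} f` by a definite amount. -/
theorem exists_increment (H : WordSystem Λ Γ w₀ w₁ v) : ∃ κ C : ℝ, 0 < κ ∧ 0 ≤ C ∧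
    ∀ M : ℕ, 1 ≤ M → ∀ f, IsSmooth f → IndepOf {i | Λ i = 0} f → ∀ ε : ℝ, 0 < ε →
      ∃ f', IsSmooth f' ∧ IndepOf {i | Λ i = 0} f' ∧
        normL1 (fun x => 1 + wordDeriv w₀ f' x) ≤ normL1 (fun x => 1 + wordDeriv w₀ f x) + ε ∧
        normL1 (wordDeriv w₁ f) +
          ((M : ℝ) ^ ((w₁.map Γ).sum - (w₀.map Γ).sum))⁻¹ * κ - ε ≤ normL1 (wordDeriv w₁ f') ∧
        ∀ j, normL1 (wordDeriv (v j) f') ≤ normL1 (wordDeriv (v j) f) +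
          ((M : ℝ) ^ ((w₁.map Γ).sum - (w₀.map Γ).sum + 1))⁻¹ * C + ε := by
  obtain ⟨N, hN⟩ : ∃ N, ∀ j, (v j).length ≤ N :=
    (Set.finite_range fun j => (v j).length).bddAbove.imp fun N hN j => hN ⟨j, rfl⟩
  obtain ⟨uA, huA, huA0, huA1, huA2, huA3⟩ := exists_cos_profile w₀.length w₁.length
  obtain ⟨uB, z, huB, hz, huB0, huB1, hz01, hzpos, hzu⟩ := exists_bump_profile w₀.length
  obtain ⟨CA, hCA0, hCA⟩ := exists_circle_bound huA N
  obtain ⟨CB, hCB0, hCB⟩ := exists_circle_bound huB (max N w₁.length)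
  -- Both constants depend on the profiles only, not on `M`, `f` or `ε`.
  refine ⟨(∫ θ, z θ ∂circleMeasure) * ∫ θ, |circleDeriv^[w₁.length] uA θ| ∂circleMeasure, CA,
    by positivity, hCA0, fun M hM f hf hfΛ ε hε => ?_⟩
  set P := (w₁.map Γ).sum - (w₀.map Γ).sum
  have hP : P ≠ 0 := by have := H.lt₁; omega
  -- The bound along `w₁` loses seven such units: two in the damping, five in the growth step, four
  -- of those through the cutoff term.
  have hδ : 0 < ε / 8 := by positivity
  obtain ⟨L, hL⟩ := exists_nat_gt (CB / (ε / 8))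
  have hL0 : (0 : ℝ) < L := lt_of_le_of_lt (by positivity) hL
  have hL1 : 1 ≤ L := Nat.one_le_iff_ne_zero.2 (by rintro rfl; simp at hL0)
  have hLCB (e : ℕ) (he : e ≠ 0) : ((L : ℝ) ^ e)⁻¹ * CB ≤ ε / 8 := by
    rw [inv_mul_le_iff₀ (by positivity)]
    have h₁ : (L : ℝ) ≤ (L : ℝ) ^ e := le_self_pow₀ (by exact_mod_cast hL1) he
    rw [div_lt_iff₀ hδ] at hL
    exact hL.le.trans (by gcongr)
  have hdens {u : UnitAddCircle → ℝ} (hu : CircleSmooth u)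
      (hu1 : ∫ θ, circleDeriv^[w₀.length] u θ ∂circleMeasure = 0) {a : Fin d → ℕ} {i : Fin d}
      (ha : a i ≠ 0) :
      ∫ x, (1 + ridge a (circleDeriv^[w₀.length] u) x) ∂torusMeasure d = 1 := by
    have hc := (hu.iterate_circleDeriv w₀.length).continuous
    rw [integral_add (integrable_const _) (integrable_of_continuous (continuous_ridge a hc)),
      integral_ridge ha hc, hu1]
    simp
  -- damping with the bump profile
  obtain ⟨b, hB, ⟨i, hi⟩, hBs, hBi, hBr, hB₀, hB₁, hBv⟩ :=
    H.exists_block huB (fun j => hCB _ ((hN j).trans (le_max_left _ _))) hL1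
  have hgB : IsSmooth fun x => 1 + ridge b (circleDeriv^[w₀.length] uB) x :=
    (isSmooth_const 1).add (isSmooth_ridge b (huB.iterate_circleDeriv _))
  have hgB0 (x) : 0 ≤ 1 + ridge b (circleDeriv^[w₀.length] uB) x := huB0 _
  have hgB1 := hdens huB huB1 hi
  have hBη (x) : |wordDeriv w₁ hB x| ≤ ε / 8 := by
    rw [hB₁, abs_mul, abs_of_nonneg (by positivity)]
    exact (mul_le_mul_of_nonneg_left (hCB _ (le_max_right _ _) _) (by positivity)).trans
      (hLCB P hP)
  have evB₀ := eventually_normL1_superpose_le hBs hgB hf hfΛ hgB0 hgB1 H.ne_zero₀ (r := 1)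
    (η := 0) (fun x => by rw [hB₀]; simp) hδ
  have evB₁ := eventually_le_normL1_superpose hBs hgB hf hfΛ hgB0 hgB1 H.ne_zero₁ hBη hδ
  -- The cutoff is a ridge function with the same frequencies as the density, so the two vanish
  -- against each other pointwise.
  have evBz := eventually_cutoff_superpose_le hBs hgB hf H.ne_zero₁ (z := ridge b z)
    (fun x => hz01 _) (fun x => hzu _) hBη hδ
  have evBv := eventually_all.2 fun j =>
    eventually_normL1_superpose_le hBs hgB hf hfΛ hgB0 hgB1 (H.ne_zero j) (r := 0)
      (fun x => by simpa using (hBv j x).trans (hLCB (P + 1) P.succ_ne_zero)) hδ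
  obtain ⟨n, hn₀, hn₁, hnz, hnv⟩ := (evB₀.and (evB₁.and (evBz.and evBv))).exists
  simp only [H.sum₁, H.sum, zero_add] at hn₁ hnz hnv
  have hf₁ := isSmooth_superpose (Λ := Λ) (w₀.map Λ).sum hBs hgB hf n
  have hf₁Λ := indepOf_superpose (Λ := Λ) (w₀.map Λ).sum hBi
    ((indepOf_const _ (1 : ℝ)).add hBr) hfΛ n
  set f₁ := superpose Λ (w₀.map Λ).sum hB
    (fun x => 1 + ridge b (circleDeriv^[w₀.length] uB) x) f n
  -- growth with the cosine profile
  obtain ⟨a, hA, ⟨k, hk⟩, hAs, hAi, hAr, hA₀, hA₁, hAv⟩ :=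
    H.exists_block huA (fun j => hCA _ (hN j)) hM
  have hgA : IsSmooth fun x => 1 + ridge a (circleDeriv^[w₀.length] uA) x :=
    (isSmooth_const 1).add (isSmooth_ridge a (huA.iterate_circleDeriv _))
  have hgA0 (x) : 0 ≤ 1 + ridge a (circleDeriv^[w₀.length] uA) x := huA0 _
  have hgA1 := hdens huA huA1 hk
  have hcA := (huA.iterate_circleDeriv w₁.length).continuous
  have hA0 : ∫ x, wordDeriv w₁ hA x ∂torusMeasure d = 0 := by
    rw [hA₁, integral_const_mul, integral_ridge hk hcA, huA2, mul_zero]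
  have hAnorm : normL1 (wordDeriv w₁ hA) =
      ((M : ℝ) ^ P)⁻¹ * ∫ θ, |circleDeriv^[w₁.length] uA θ| ∂circleMeasure := by
    rw [hA₁, ← integral_ridge hk hcA.abs, ← integral_const_mul]
    refine integral_congr_ae (Eventually.of_forall fun x => ?_)
    dsimp only
    rw [abs_mul, abs_of_nonneg (by positivity)]
    rfl
  have evA₀ := eventually_normL1_superpose_le hAs hgA hf₁ hf₁Λ hgA0 hgA1 H.ne_zero₀ (r := 1)
    (η := 0) (fun x => by rw [hA₀]; simp) hδ
  have evA₁ := eventually_le_normL1_superpose_of_cutoff hAs hgA hf₁ hf₁Λ hgA0 hgA1 H.ne_zero₁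
    hA0 (continuous_ridge b hz) (fun x => hz01 _) hnz hδ
  have evAv := eventually_all.2 fun j =>
    eventually_normL1_superpose_le hAs hgA hf₁ hf₁Λ hgA0 hgA1 (H.ne_zero j) (r := 0)
      (fun x => by simpa using hAv j x) hδ
  obtain ⟨m, hm₀, hm₁, hmv⟩ := (evA₀.and (evA₁.and evAv)).exists
  simp only [H.sum₁, H.sum, zero_add] at hm₁ hmv
  refine ⟨_, isSmooth_superpose (Λ := Λ) (w₀.map Λ).sum hAs hgA hf₁ m,
    indepOf_superpose (Λ := Λ) (w₀.map Λ).sum hAi ((indepOf_const _ (1 : ℝ)).add hAr) hf₁Λ m,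
    by linarith, ?_, fun j => ?_⟩
  · rw [hAnorm, integral_ridge hi hz, mul_left_comm] at hm₁
    linarith
  · linarith [hnv j, hmv j]

theorem exists_growth (H : WordSystem Λ Γ w₀ w₁ v) : ∃ κ C : ℝ, 0 < κ ∧ 0 ≤ C ∧
    ∀ M : ℕ, 1 ≤ M → ∀ n : ℕ, ∀ ε : ℝ, 0 < ε →
      ∃ f, IsSmooth f ∧ IndepOf {i | Λ i = 0} f ∧
        normL1 (fun x => 1 + wordDeriv w₀ f x) ≤ 1 + ε ∧
        n * (((M : ℝ) ^ ((w₁.map Γ).sum - (w₀.map Γ).sum))⁻¹ * κ) - ε ≤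
          normL1 (wordDeriv w₁ f) ∧
        ∀ j, normL1 (wordDeriv (v j) f) ≤
          n * (((M : ℝ) ^ ((w₁.map Γ).sum - (w₀.map Γ).sum + 1))⁻¹ * C) + ε := by
  obtain ⟨κ, C, hκ, hC, h⟩ := H.exists_increment
  refine ⟨κ, C, hκ, hC, fun M hM n => ?_⟩
  induction n with
  | zero =>
    intro ε hε
    refine ⟨fun _ => 0, isSmooth_const 0, indepOf_const _ 0, ?_, ?_, fun j => ?_⟩ <;>
      simp [wordDeriv_zero, normL1, hε.le]
  | succ n ih =>
    intro ε hε
    obtain ⟨f, hf, hfΛ, h₀, h₁, hv⟩ := ih (ε / 2) (half_pos hε)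
    obtain ⟨f', hf', hfΛ', h₀', h₁', hv'⟩ := h M hM f hf hfΛ (ε / 2) (half_pos hε)
    refine ⟨f', hf', hfΛ', by linarith, ?_, fun j => ?_⟩
    · push_cast; linarith
    · push_cast; linarith [hv j, hv' j]

theorem exists_large (H : WordSystem Λ Γ w₀ w₁ v) {K : ℝ} (hK : 0 < K) :
    ∃ f, IsSmooth f ∧ IndepOf {i | Λ i = 0} f ∧ 0 < normL1 (wordDeriv w₁ f) ∧
      K * normL1 (wordDeriv w₀ f) ≤ normL1 (wordDeriv w₁ f) ∧
      ∀ j, K * normL1 (wordDeriv (v j) f) ≤ normL1 (wordDeriv w₁ f) := by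
  obtain ⟨κ, C, hκ, hC, h⟩ := H.exists_growth
  set P := (w₁.map Γ).sum - (w₀.map Γ).sum
  -- With this `M`, `K` times the growth per round along `v j` is at most half the growth `q` along
  -- `w₁`.
  obtain ⟨M, hM⟩ := exists_nat_gt (2 * K * C / κ)
  have hM0 : (0 : ℝ) < M := lt_of_le_of_lt (by positivity) hM
  have hM1 : 1 ≤ M := Nat.one_le_iff_ne_zero.2 (by rintro rfl; simp at hM0)
  set q := ((M : ℝ) ^ P)⁻¹ * κ
  have hq : 0 < q := by positivity
  have hqC : K * (((M : ℝ) ^ (P + 1))⁻¹ * C) ≤ q / 2 := by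
    rw [div_lt_iff₀ hκ] at hM
    have : K * C * (M : ℝ)⁻¹ ≤ κ / 2 := by
      rw [← div_eq_mul_inv, div_le_iff₀ hM0]; linarith
    calc K * (((M : ℝ) ^ (P + 1))⁻¹ * C) = ((M : ℝ) ^ P)⁻¹ * (K * C * (M : ℝ)⁻¹) := by
          rw [pow_succ, mul_inv]; ring
      _ ≤ ((M : ℝ) ^ P)⁻¹ * (κ / 2) := by gcongr
      _ = q / 2 := by ring
  -- Sufficient are `n * q ≥ 3 * K + 1` for `w₀` and `n * q / 2 ≥ K + 1` for the `v j`.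
  obtain ⟨n, hn⟩ := exists_nat_gt ((6 * K + 4) / q)
  rw [div_lt_iff₀ hq] at hn
  obtain ⟨f, hf, hfΛ, h₀, h₁, hv⟩ := h M hM1 n 1 one_pos
  have hw₀ : normL1 (wordDeriv w₀ f) ≤ 3 := by
    have hc := (hf.wordDeriv w₀).continuous
    have : normL1 (wordDeriv w₀ f) ≤ ∫ x, (|1 + wordDeriv w₀ f x| + 1) ∂torusMeasure d := by
      refine integral_mono_of_continuous (by fun_prop) (by fun_prop) fun x => ?_
      have := abs_sub (1 + wordDeriv w₀ f x) 1
      simpa using this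
    rw [integral_add (integrable_of_continuous (by fun_prop)) (integrable_const _)] at this
    simp only [integral_const, probReal_univ, smul_eq_mul, mul_one] at this
    have h₀' : ∫ x, |1 + wordDeriv w₀ f x| ∂torusMeasure d ≤ 1 + 1 := h₀
    linarith
  refine ⟨f, hf, hfΛ, by linarith, ?_, fun j => ?_⟩
  · have := mul_le_mul_of_nonneg_left hw₀ hK.le
    linarith
  · have h₂ := mul_le_mul_of_nonneg_left (hv j) hK.le
    have h₃ := mul_le_mul_of_nonneg_left hqC (Nat.cast_nonneg (α := ℝ) n)
    have h₄ : K * (n * (((M : ℝ) ^ (P + 1))⁻¹ * C) + 1) =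
      n * (K * (((M : ℝ) ^ (P + 1))⁻¹ * C)) + K := by ring
    linarith

end WordSystem

/-! ### Coordinates of weight zero -/

/-- A translation in the coordinates of `S` leaves `f` unchanged and acts on `g` like an arbitrary
translation `s`; averaging over `s` separates the integrals. -/
theorem normL1_mul_of_indepOf {S : Set (Fin d)} {f g : UnitAddTorus (Fin d) → ℝ}
    (hf : Continuous f) (hg : Continuous g) (hfS : IndepOf S f) (hgS : IndepOf Sᶜ g) :
    normL1 (fun x => f x * g x) = normL1 f * normL1 g := by
  classical
  have key (s : UnitAddTorus (Fin d)) :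
      normL1 (fun x => f x * g x) = ∫ x, |f x| * |g (x + s)| ∂torusMeasure d := by
    let t : UnitAddTorus (Fin d) := fun i => if i ∈ S then s i else 0
    refine (integral_add_right_eq_self (μ := torusMeasure d)
      (fun x => |f x * g x|) t).symm.trans ?_
    refine integral_congr_ae (Eventually.of_forall fun x => ?_)
    have hft : f (x + t) = f x := hfS x t fun i hi => if_neg hi
    have hgt : g (x + t + (s - t)) = g (x + t) := hgS _ _ fun i hi => by
      simp [t, Set.notMem_compl_iff.1 hi]
    rw [add_assoc, add_sub_cancel] at hgt
    simp only [abs_mul, hft, hgt]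
  have hcont : Continuous fun p : UnitAddTorus (Fin d) × UnitAddTorus (Fin d) =>
      |f p.1| * |g (p.1 + p.2)| := by fun_prop
  calc normL1 (fun x => f x * g x)
      = ∫ _ : UnitAddTorus (Fin d), normL1 (fun x => f x * g x) ∂torusMeasure d := by simp
    _ = ∫ s, ∫ x, |f x| * |g (x + s)| ∂torusMeasure d ∂torusMeasure d := by simp only [← key]
    _ = ∫ x, ∫ s, |f x| * |g (x + s)| ∂torusMeasure d ∂torusMeasure d :=
      (integral_integral_swap (hcont.integrable_of_hasCompactSupport
        (HasCompactSupport.of_compactSpace _))).symm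
    _ = normL1 f * normL1 g := by
      simp only [integral_const_mul]
      rw [normL1, ← integral_mul_const]
      refine integral_congr_ae (Eventually.of_forall fun x => ?_)
      dsimp only
      rw [integral_add_left_eq_self (μ := torusMeasure d) (fun y => |g y|) x, normL1]

theorem sum_map_filter_notMem {S : Set (Fin d)} [DecidablePred (· ∈ S)] {β : Fin d → ℕ}
    (hβ : ∀ i ∈ S, β i = 0) (w : List (Fin d)) :
    ((w.filter (· ∉ S)).map β).sum = (w.map β).sum := by
  induction w with
  | nil => rfl
  | cons i w ih =>
    by_cases hi : i ∈ S
    · simpa [hi, hβ i hi] using ih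
    · simpa [hi] using ih

/-- A smooth function of the coordinates in `S` all of whose derivatives are nonzero. -/
theorem exists_isSmooth_forall_normL1_pos (S : Set (Fin d)) :
    ∃ g : UnitAddTorus (Fin d) → ℝ, IsSmooth g ∧ IndepOf Sᶜ g ∧
      ∀ w : List (Fin d), (∀ i ∈ w, i ∈ S) → 0 < normL1 (wordDeriv w g) := by
  classical
  let a : Fin d → ℕ := fun i => if i ∈ S then 1 else 0
  -- With phase `π / 4`, no derivative vanishes at the origin: its phase there is an odd multiple of
  -- `π / 4`.
  have hg : IsSmooth (ridge a (cosWave (Real.pi / 4))) := isSmooth_ridge a (circleSmooth_cosWave _)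
  refine ⟨_, hg, indepOf_ridge (fun i hi => if_neg hi) _, fun w hw => ?_⟩
  refine (hg.wordDeriv w).continuous.abs.integral_pos_of_hasCompactSupport_nonneg_nonzero
    (x := 0) (HasCompactSupport.of_compactSpace _) (fun _ => abs_nonneg _) ?_
  have hprod : (w.map fun i => (a i : ℝ)).prod = 1 :=
    List.prod_eq_one fun y hy => by
      obtain ⟨i, hi, rfl⟩ := List.mem_map.1 hy
      simp [a, hw i hi]
  have hcos (n : ℕ) : Real.cos (Real.pi / 4 + n * (Real.pi / 2)) ≠ 0 := fun h => by
    obtain ⟨k, hk⟩ := Real.cos_eq_zero_iff.1 h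
    have hpi := Real.pi_pos.ne'
    have h₁ : (1 + 2 * n : ℝ) = 2 * (2 * k + 1) := by
      have : Real.pi * (1 + 2 * n) = Real.pi * (2 * (2 * k + 1)) := by linarith
      exact mul_left_cancel₀ hpi this
    have h₂ : (1 + 2 * n : ℤ) = 2 * (2 * k + 1) := by exact_mod_cast h₁
    omega
  have h0 (c : ℝ) : cosWave c 0 = Real.cos c := by
    have := cosWave_coe c 0
    simpa using this
  rw [wordDeriv_ridge, hprod, iterate_circleDeriv_cosWave]
  simp only [ridge, Pi.zero_apply, smul_zero, Finset.sum_const_zero, h0, one_mul]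
  exact abs_ne_zero.2 (mul_ne_zero (by positivity) (hcos _))

end TorusDeriv

end

/-! ### Separation of variables and conclusion -/

theorem mainTheorem1 (d m : ℕ) (hm : 1 ≤ m) (α : Fin (m + 1) → Fin d → ℕ) (Γ Λ : Fin d → ℕ)
    (hΓΛ : ∀ i : Fin d, Λ i = 0 → Γ i = 0)
    (hΛ : ∀ j : Fin (m + 1), α j ⬝ᵥ Λ = α 0 ⬝ᵥ Λ)
    (h01 : α 0 ⬝ᵥ Γ < α 1 ⬝ᵥ Γ)
    (h12 : ∀ j : Fin (m + 1), (j : ℕ) = 2 → α 1 ⬝ᵥ Γ < α j ⬝ᵥ Γ)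
    (hmono : ∀ i j : Fin (m + 1), 2 ≤ (i : ℕ) → i ≤ j → α i ⬝ᵥ Γ ≤ α j ⬝ᵥ Γ)
    (K : ℝ) (hK : 0 < K) :
    ∃ f : UnitAddTorus (Fin d) → ℝ, TorusDeriv.IsSmooth f ∧
      0 < TorusDeriv.normL1 (TorusDeriv.multiDeriv (α 1) f) ∧
      K * ∑ j ∈ Finset.univ.erase (1 : Fin (m + 1)),
          TorusDeriv.normL1 (TorusDeriv.multiDeriv (α j) f)
        ≤ TorusDeriv.normL1 (TorusDeriv.multiDeriv (α 1) f) := by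
  open TorusDeriv in
  let S : Set (Fin d) := {i | Λ i = 0}
  let w : Fin (m + 1) → List (Fin d) := fun j => (word (α j)).filter (· ∉ S)
  let w' : Fin (m + 1) → List (Fin d) := fun j => (word (α j)).filter (· ∈ S)
  have hwS (j) : ∀ i ∈ w j, Λ i ≠ 0 := fun i hi => by
    simpa [S] using (List.mem_filter.1 hi).2
  have hwΛ (j) : ((w j).map Λ).sum = α j ⬝ᵥ Λ :=
    (sum_map_filter_notMem (S := S) (fun i hi => hi) _).trans (sum_map_word _ _)
  have hwΓ (j) : ((w j).map Γ).sum = α j ⬝ᵥ Γ :=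
    (sum_map_filter_notMem (S := S) hΓΛ _).trans (sum_map_word _ _)
  -- Index 2 exists as soon as some `j ≥ 2` does; for `m = 1` the family `v` below is empty.
  have hlt (j : Fin (m + 1)) (hj : 2 ≤ (j : ℕ)) : α 1 ⬝ᵥ Γ < α j ⬝ᵥ Γ :=
    (h12 ⟨2, by omega⟩ rfl).trans_le (hmono ⟨2, by omega⟩ j le_rfl hj)
  have H : WordSystem Λ Γ (w 0) (w 1) fun j : {j : Fin (m + 1) // 2 ≤ (j : ℕ)} => w j :=
    { ne_zero₀ := hwS 0
      ne_zero₁ := hwS 1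
      ne_zero := fun j => hwS j
      sum₁ := by rw [hwΛ, hwΛ, hΛ]
      sum := fun j => by rw [hwΛ, hwΛ, hΛ]
      lt₁ := by rwa [hwΓ, hwΓ]
      lt := fun j => by rw [hwΓ, hwΓ]; exact hlt j j.2 }
  obtain ⟨g, hg, hgS, hgpos⟩ := exists_isSmooth_forall_normL1_pos S
  have hpos (j) : 0 < normL1 (wordDeriv (w' j) g) :=
    hgpos _ fun i hi => by simpa using (List.mem_filter.1 hi).2
  set E := ∑ j, normL1 (wordDeriv (w' j) g)
  have hE : 0 < E := Finset.sum_pos (fun j _ => hpos j) Finset.univ_nonempty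
  -- The enlarged constant absorbs the norms of the derivatives of `g`, whose sum over all `j` is
  -- `E`.
  obtain ⟨f, hf, hfS, hf₁, hf₀, hfv⟩ := H.exists_large
    (K := K * E / normL1 (wordDeriv (w' 1) g)) (div_pos (mul_pos hK hE) (hpos 1))
  have hD (j) : normL1 (multiDeriv (α j) fun x => f x * g x) =
      normL1 (wordDeriv (w j) f) * normL1 (wordDeriv (w' j) g) := by
    rw [multiDeriv_eq_wordDeriv, wordDeriv_mul_of_indepOf hf hg hfS hgS]
    exact normL1_mul_of_indepOf (hf.wordDeriv _).continuous (hg.wordDeriv _).continuous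
      (hfS.wordDeriv _) (hgS.wordDeriv _)
  have hle (j : Fin (m + 1)) (hj : j ≠ 1) : K * E * normL1 (wordDeriv (w j) f) ≤
      normL1 (wordDeriv (w 1) f) * normL1 (wordDeriv (w' 1) g) := by
    have h : K * E / normL1 (wordDeriv (w' 1) g) * normL1 (wordDeriv (w j) f) ≤
        normL1 (wordDeriv (w 1) f) := by
      rcases eq_or_ne j 0 with rfl | h0
      · exact hf₀
      · refine hfv ⟨j, ?_⟩
        have h₀ : (j : ℕ) ≠ 0 := fun h => h0 (Fin.ext h)
        have h₁ : (j : ℕ) ≠ 1 := fun h => hj (Fin.ext (by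
          rw [h, Fin.val_one', Nat.mod_eq_of_lt (by omega)]))
        omega
    rwa [div_mul_eq_mul_div, div_le_iff₀ (hpos 1)] at h
  refine ⟨fun x => f x * g x, hf.mul hg, by rw [hD]; exact mul_pos hf₁ (hpos 1), ?_⟩
  simp only [hD]
  refine le_of_mul_le_mul_left ?_ hE
  calc E * (K * ∑ j ∈ Finset.univ.erase 1,
        normL1 (wordDeriv (w j) f) * normL1 (wordDeriv (w' j) g))
      = ∑ j ∈ Finset.univ.erase 1,
        K * E * normL1 (wordDeriv (w j) f) * normL1 (wordDeriv (w' j) g) := by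
        rw [Finset.mul_sum, Finset.mul_sum]
        exact Finset.sum_congr rfl fun j _ => by ring
    _ ≤ ∑ j ∈ Finset.univ.erase 1, normL1 (wordDeriv (w 1) f) *
        normL1 (wordDeriv (w' 1) g) * normL1 (wordDeriv (w' j) g) :=
        Finset.sum_le_sum fun j hj =>
          mul_le_mul_of_nonneg_right (hle j (Finset.ne_of_mem_erase hj)) (hpos j).le
    _ ≤ ∑ j, normL1 (wordDeriv (w 1) f) *
        normL1 (wordDeriv (w' 1) g) * normL1 (wordDeriv (w' j) g) :=
        Finset.sum_le_sum_of_subset_of_nonneg (Finset.erase_subset _ _) fun j _ _ =>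
          mul_nonneg (mul_pos hf₁ (hpos 1)).le (hpos j).le
    _ = E * (normL1 (wordDeriv (w 1) f) * normL1 (wordDeriv (w' 1) g)) := by
        rw [← Finset.mul_sum, mul_comm]
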